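/- **Proposition 3.3 (Codazzi for a given immersion).** Let $N\ge 2$, $0\le\lambda\le N$, $c,\varepsilon\in\{-1,1\}$. Let $\mathbb{M}^N_\lambda(c)$ be a connected component of the hyperquadric $\{p : g_0(p,p)=c\}$ of the pseudo-Euclidean space $(\mathbb{R}^{N+1},g_0)$ of index $\lambda$ if $c=1$ and of index $\lambda+1$ if $c=-1$, with the induced metric $g_{\mathbb M}$ (of index $\lambda$). Let $I\subset\mathbb{R}$ be an open interval, $a:I\to(0,\infty)$ a smooth function, and let $\bar P=\varepsilon I\times_a\mathbb{M}^N_\lambda(c)$ be the manifold $I\times\mathbb{M}^N_\lambda(c)$ with the metric $\langle\,,\rangle=\varepsilon\,dt^2+a(t)^2g_{\mathbb M}$. Let $(M^n,\langle\,,\rangle)$ be a semi-Riemannian manifold and $f:M\to\bar P$ an isometric immersion, let $\bar\nabla$ and $\nabla$ be the Levi-Civita connections of $\bar P$ and $M$ ($\bar\nabla$ also denotes the induced derivative of vector fields along $f$), and let $\nabla^\perp$ be the normal connection and $\alpha(X,Z)=(\bar\nabla_X\,df(Z))^\perp$ the second fundamental form of $f$. Let $\pi:M\to I$ be the first component of $f$,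 and put $T=\varepsilon\,\mathrm{grad}(\pi)$ and $\xi=\partial t-T$, a normal field along $f$ (tangent vectors of $M$ are identified with their images under $df$). For vector fields $X,Y,Z$ on $M$ and a normal field $\eta$, all smooth (possibly only locally defined), let $$(\bar\nabla_Y\alpha)(X,Z,\eta)=Y\langle\alpha(X,Z),\eta\rangle-\langle\alpha(\nabla_YX,Z),\eta\rangle-\langle\alpha(X,\nabla_YZ),\eta\rangle-\langle\alpha(X,Z),\nabla^\perp_Y\eta\rangle .$$ Then, with $a,a',a''$ evaluated at $\pi$, $$(\bar\nabla_Y\alpha)(X,Z,\eta)-(\bar\nabla_X\alpha)(Y,Z,\eta)=\left(\frac{a''}{a}-\frac{(a')^2}{a^2}+\frac{\varepsilon c}{a^2}\right)\langle\xi,\eta\rangle\big(\langle T,X\rangle\langle Y,Z\rangle-\langle T,Y\rangle\langle X,Z\rangle\big).$$ -/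

import Mathlib

open Set Module
open scoped Manifold ContDiff Topology

noncomputable section

namespace WarpedCodazzi

/-! ### The pseudo-Euclidean space and its central hyperquadrics -/

/-- The underlying vector space of the pseudo-Euclidean space of dimension `N + 1`. -/
abbrev Ambient (N : ℕ) : Type := EuclideanSpace ℝ (Fin (N + 1))

/-- The flat metric of index `ν` on `ℝ^{N+1}`: the coordinates `x_0, …, x_{N-ν}` carry the
sign `+1` and the last `ν` coordinates the sign `-1`. -/
def flatMetric (N ν : ℕ) : Ambient N →L[ℝ] Ambient N →L[ℝ] ℝ :=
  ∑ i : Fin (N + 1), (if (i : ℕ) + ν < N + 1 then (1 : ℝ) else -1) •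
    (EuclideanSpace.proj i : Ambient N →L[ℝ] ℝ).smulRight
      (EuclideanSpace.proj i : Ambient N →L[ℝ] ℝ)

theorem flatMetric_apply (N ν : ℕ) (x y : Ambient N) :
    flatMetric N ν x y =
      ∑ i : Fin (N + 1), (if (i : ℕ) + ν < N + 1 then (1 : ℝ) else -1) * (x i * y i) := by
  simp only [flatMetric, sum_apply, smul_apply,
    ContinuousLinearMap.smulRight_apply, smul_eq_mul]
  rfl

theorem flatMetric_symm (N ν : ℕ) (x y : Ambient N) :
    flatMetric N ν x y = flatMetric N ν y x := by
  simp only [flatMetric_apply, mul_comm (x _)]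

/-- The hyperquadric `{x ; g₀(x, x) = c}`, `c = ±1`, of the pseudo-Euclidean space of dimension
`N + 1` and index `ν`. -/
@[ext]
structure Quadric (N ν : ℕ) (c : ℤˣ) where
  val : Ambient N
  self_eq : flatMetric N ν val val = ((c : ℤ) : ℝ)

instance (N ν : ℕ) (c : ℤˣ) : CoeOut (Quadric N ν c) (Ambient N) := ⟨Quadric.val⟩

/-- The hyperquadric carries the subspace topology. -/
instance (N ν : ℕ) (c : ℤˣ) : TopologicalSpace (Quadric N ν c) :=
  TopologicalSpace.induced Quadric.val inferInstance

variable {N ν : ℕ} {c : ℤˣ}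

theorem sign_mul_self (c : ℤˣ) : ((c : ℤ) : ℝ) * ((c : ℤ) : ℝ) = 1 := by
  rcases Int.units_eq_one_or c with rfl | rfl <;> simp

theorem Quadric.isInducing_val : Topology.IsInducing (Quadric.val : Quadric N ν c → Ambient N) :=
  ⟨rfl⟩

@[fun_prop]
theorem Quadric.continuous_val : Continuous (Quadric.val : Quadric N ν c → Ambient N) :=
  Quadric.isInducing_val.continuous

/-- A linear identification of `ℝ^N` with the `g₀`-orthogonal complement of a point `p` of the
hyperquadric. -/
def Quadric.perpEquiv (p : Quadric N ν c) :
    LinearMap.ker (flatMetric N ν (p : Ambient N) : Ambient N →ₗ[ℝ] ℝ) ≃L[ℝ]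
      EuclideanSpace ℝ (Fin N) :=
  ContinuousLinearEquiv.ofFinrankEq (by
    have hne : (flatMetric N ν (p : Ambient N) : Ambient N →ₗ[ℝ] ℝ) ≠ 0 := by
      intro h
      have h1 := p.self_eq
      have h2 : flatMetric N ν (p : Ambient N) (p : Ambient N) = 0 :=
        LinearMap.congr_fun h (p : Ambient N)
      have h3 := sign_mul_self c
      rw [← h1, h2] at h3
      simp at h3
    have h := Module.Dual.finrank_ker_add_one_of_ne_zero (K := ℝ) hne
    simp only [finrank_euclideanSpace, Fintype.card_fin] at h ⊢
    omega)

/-- The `g₀`-orthogonal projection `x ↦ x - c g₀(p, x) p` onto `p^⊥`, read in `ℝ^N`. -/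
def Quadric.toPerp (p : Quadric N ν c) : Ambient N →L[ℝ] EuclideanSpace ℝ (Fin N) :=
  (p.perpEquiv : _ →L[ℝ] EuclideanSpace ℝ (Fin N)).comp
    ((ContinuousLinearMap.id ℝ (Ambient N) -
      (((c : ℤ) : ℝ) • (flatMetric N ν (p : Ambient N))).smulRight (p : Ambient N)).codRestrict
      (LinearMap.ker (flatMetric N ν (p : Ambient N) : Ambient N →ₗ[ℝ] ℝ)) (by
        intro x
        have h3 := sign_mul_self c
        have h1 := p.self_eq
        simp only [LinearMap.mem_ker, ContinuousLinearMap.coe_coe,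
          sub_apply, ContinuousLinearMap.id_apply,
          ContinuousLinearMap.smulRight_apply, smul_apply, map_sub, map_smul,
          smul_eq_mul, h1]
        linear_combination (-flatMetric N ν (p : Ambient N) x) * h3))

/-- The inclusion of `p^⊥`, read in `ℝ^N`, into the ambient space. -/
def Quadric.ofPerp (p : Quadric N ν c) : EuclideanSpace ℝ (Fin N) →L[ℝ] Ambient N :=
  (LinearMap.ker (flatMetric N ν (p : Ambient N) : Ambient N →ₗ[ℝ] ℝ)).subtypeL.comp
    (p.perpEquiv.symm : EuclideanSpace ℝ (Fin N) →L[ℝ] _)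

theorem Quadric.flatMetric_ofPerp (p : Quadric N ν c) (y : EuclideanSpace ℝ (Fin N)) :
    flatMetric N ν (p : Ambient N) (p.ofPerp y) = 0 :=
  (p.perpEquiv.symm y).2

theorem Quadric.ofPerp_toPerp (p : Quadric N ν c) (x : Ambient N) :
    p.ofPerp (p.toPerp x) =
      x - (((c : ℤ) : ℝ) * flatMetric N ν (p : Ambient N) x) • (p : Ambient N) := by
  simp [Quadric.ofPerp, Quadric.toPerp]

theorem Quadric.toPerp_ofPerp (p : Quadric N ν c) (y : EuclideanSpace ℝ (Fin N)) :
    p.toPerp (p.ofPerp y) = y := by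
  rw [Quadric.toPerp, ContinuousLinearMap.comp_apply, ContinuousLinearEquiv.coe_coe,
    ← ContinuousLinearEquiv.eq_symm_apply]
  apply Subtype.ext
  simp [ContinuousLinearMap.coe_codRestrict_apply, p.flatMetric_ofPerp y]
  rfl

theorem Quadric.toPerp_self (p : Quadric N ν c) : p.toPerp (p : Ambient N) = 0 := by
  have h : p.ofPerp (p.toPerp (p : Ambient N)) = 0 := by
    rw [p.ofPerp_toPerp, p.self_eq, sign_mul_self, one_smul, sub_self]
  rw [← p.toPerp_ofPerp (p.toPerp (p : Ambient N)), h, map_zero]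

/-- The function `1 - c g₀(y, y)` on `p^⊥`. -/
def Quadric.height (p : Quadric N ν c) (y : EuclideanSpace ℝ (Fin N)) : ℝ :=
  1 - ((c : ℤ) : ℝ) * flatMetric N ν (p.ofPerp y) (p.ofPerp y)

theorem Quadric.contDiff_height (p : Quadric N ν c) {k : ℕ∞ω} : ContDiff ℝ k p.height := by
  unfold Quadric.height
  have h1 : ContDiff ℝ k fun y => p.ofPerp y := p.ofPerp.contDiff
  have h2 : ContDiff ℝ k fun y => flatMetric N ν (p.ofPerp y) :=
    ((flatMetric N ν).comp p.ofPerp).contDiff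
  exact contDiff_const.sub (contDiff_const.mul (h2.clm_apply h1))

/-- The point `y + √(1 - c g₀(y, y)) p` of the hyperquadric lying over `y ∈ p^⊥`. -/
def Quadric.lift (p : Quadric N ν c) (y : EuclideanSpace ℝ (Fin N)) : Ambient N :=
  p.ofPerp y + √(p.height y) • (p : Ambient N)

theorem Quadric.lift_mem (p : Quadric N ν c) (y : EuclideanSpace ℝ (Fin N))
    (hy : 0 ≤ p.height y) : flatMetric N ν (p.lift y) (p.lift y) = ((c : ℤ) : ℝ) := by
  have h0 := p.flatMetric_ofPerp y
  have h0' : flatMetric N ν (p.ofPerp y) (p : Ambient N) = 0 := by rw [flatMetric_symm, h0]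
  have h1 := p.self_eq
  have h2 := Real.mul_self_sqrt hy
  have h3 := sign_mul_self c
  simp only [Quadric.lift, map_add, map_smul,
    add_apply, smul_apply, smul_eq_mul, h0, h0', h1]
  have h4 : p.height y = 1 - ((c : ℤ) : ℝ) * flatMetric N ν (p.ofPerp y) (p.ofPerp y) := rfl
  rw [h4] at h2 ⊢
  linear_combination ((c : ℤ) : ℝ) * h2 - flatMetric N ν (p.ofPerp y) (p.ofPerp y) * h3

theorem Quadric.flatMetric_lift (p : Quadric N ν c) (y : EuclideanSpace ℝ (Fin N)) :
    ((c : ℤ) : ℝ) * flatMetric N ν (p : Ambient N) (p.lift y) = √(p.height y) := by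
  have h3 := sign_mul_self c
  simp only [Quadric.lift, map_add, map_smul, smul_eq_mul, p.flatMetric_ofPerp y, p.self_eq]
  linear_combination √(p.height y) * h3

theorem Quadric.toPerp_lift (p : Quadric N ν c) (y : EuclideanSpace ℝ (Fin N)) :
    p.toPerp (p.lift y) = y := by
  simp [Quadric.lift, p.toPerp_ofPerp, p.toPerp_self]

theorem Quadric.height_toPerp (p x : Quadric N ν c) :
    p.height (p.toPerp (x : Ambient N)) =
      (((c : ℤ) : ℝ) * flatMetric N ν (p : Ambient N) (x : Ambient N)) ^ 2 := by
  have h3 := sign_mul_self c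
  simp only [Quadric.height, p.ofPerp_toPerp, map_sub, map_smul, sub_apply,
    smul_apply, smul_eq_mul, p.self_eq, x.self_eq,
    flatMetric_symm N ν (x : Ambient N) (p : Ambient N)]
  linear_combination (-1 - ((c : ℤ) : ℝ) ^ 2 *
    flatMetric N ν (p : Ambient N) (x : Ambient N) ^ 2) * h3

open Classical in
/-- The chart at `p`: the part `{x ; c g₀(p, x) > 0}` of the hyperquadric is a graph over an open
subset of `p^⊥` by orthogonal projection. -/
def Quadric.chart (p : Quadric N ν c) :
    OpenPartialHomeomorph (Quadric N ν c) (EuclideanSpace ℝ (Fin N)) where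
  toFun x := p.toPerp (x : Ambient N)
  invFun y := if hy : 0 < p.height y then ⟨p.lift y, p.lift_mem y hy.le⟩ else p
  source := {x | 0 < ((c : ℤ) : ℝ) * flatMetric N ν (p : Ambient N) (x : Ambient N)}
  target := {y | 0 < p.height y}
  map_source' := by
    intro x hx
    simp only [Set.mem_ofPred_eq] at hx ⊢
    rw [p.height_toPerp]
    positivity
  map_target' := by
    intro y hy
    simp only [Set.mem_ofPred_eq] at hy ⊢
    rw [dif_pos hy, p.flatMetric_lift]
    exact Real.sqrt_pos.2 hy
  left_inv' := by
    intro x hx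
    simp only [Set.mem_ofPred_eq] at hx
    have h : 0 < p.height (p.toPerp (x : Ambient N)) := by rw [p.height_toPerp]; positivity
    rw [dif_pos h]
    apply Quadric.ext
    simp only [Quadric.lift]
    rw [p.height_toPerp, Real.sqrt_sq hx.le, p.ofPerp_toPerp, sub_add_cancel]
  right_inv' := by
    intro y hy
    simp only [Set.mem_ofPred_eq] at hy
    rw [dif_pos hy]
    exact p.toPerp_lift y
  open_source := by
    apply isOpen_lt continuous_const
    fun_prop
  open_target := isOpen_lt continuous_const (p.contDiff_height (k := 0)).continuous
  continuousOn_toFun := by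
    apply Continuous.continuousOn
    fun_prop
  continuousOn_invFun := by
    rw [Quadric.isInducing_val.continuousOn_iff]
    have h : Continuous p.lift := by
      have := (p.contDiff_height (k := 0)).continuous
      unfold Quadric.lift
      fun_prop
    refine h.continuousOn.congr ?_
    intro y hy
    simp only [Set.mem_ofPred_eq] at hy
    simp [dif_pos hy]

instance Quadric.instChartedSpace :
    ChartedSpace (EuclideanSpace ℝ (Fin N)) (Quadric N ν c) where
  atlas := {e | ∃ p : Quadric N ν c, e = p.chart}
  chartAt p := p.chart
  mem_chart_source p := by
    simp [Quadric.chart, p.self_eq, sign_mul_self]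
  chart_mem_atlas p := ⟨p, rfl⟩

instance Quadric.instIsManifold : IsManifold (𝓡 N) ∞ (Quadric N ν c) :=
  isManifold_of_contDiffOn (𝓡 N) ∞ (Quadric N ν c) (by
    rintro _ _ ⟨p, rfl⟩ ⟨q, rfl⟩
    have key : ContDiffOn ℝ ∞ (fun y => q.toPerp (p.lift y)) {y | 0 < p.height y} := by
      apply q.toPerp.contDiff.comp_contDiffOn
      intro y hy
      unfold Quadric.lift
      refine (p.ofPerp.contDiff.contDiffAt.add
        (ContDiffAt.smul (ContDiffAt.sqrt p.contDiff_height.contDiffAt ?_)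
          contDiffAt_const)).contDiffWithinAt
      exact ne_of_gt hy
    refine (key.mono ?_).congr ?_
    · intro y hy
      exact hy.1.1
    · intro y hy
      have hy' : 0 < p.height y := hy.1.1
      simp [Quadric.chart, dif_pos hy'])

instance Quadric.instLocallyConnectedSpace : LocallyConnectedSpace (Quadric N ν c) :=
  ChartedSpace.locallyConnectedSpace (EuclideanSpace ℝ (Fin N)) (Quadric N ν c)

/-- The connected component, through the point `o`, of the hyperquadric. -/
def spaceForm (o : Quadric N ν c) : TopologicalSpace.Opens (Quadric N ν c) :=
  ⟨connectedComponent o, isOpen_connectedComponent⟩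

/-- The index of the pseudo-Euclidean space that contains the space form of index `l` and
constant curvature `c`: it is `l` if `c = 1` and `l + 1` if `c = -1`. -/
def ambientIndex (l : ℕ) (c : ℤˣ) : ℕ := if c = 1 then l else l + 1

/-- The bilinear form `(u, v) ↦ B(L u, L v)`. -/
def pullForm {V W : Type*} [AddCommGroup V] [Module ℝ V] [TopologicalSpace V]
    [IsTopologicalAddGroup V] [ContinuousSMul ℝ V]
    [AddCommGroup W] [Module ℝ W] [TopologicalSpace W]
    [IsTopologicalAddGroup W] [ContinuousSMul ℝ W]
    (B : W →L[ℝ] W →L[ℝ] ℝ) (L : V →L[ℝ] W) : V →L[ℝ] V →L[ℝ] ℝ :=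
  (ContinuousLinearMap.precomp ℝ L).comp (B.comp L)

theorem pullForm_apply {V W : Type*} [AddCommGroup V] [Module ℝ V] [TopologicalSpace V]
    [IsTopologicalAddGroup V] [ContinuousSMul ℝ V]
    [AddCommGroup W] [Module ℝ W] [TopologicalSpace W]
    [IsTopologicalAddGroup W] [ContinuousSMul ℝ W]
    (B : W →L[ℝ] W →L[ℝ] ℝ) (L : V →L[ℝ] W) (u v : V) :
    pullForm B L u v = B (L u) (L v) := rfl

/-- The metric that a space form inherits from the pseudo-Euclidean space. -/
def spaceFormMetric (o : Quadric N ν c) (p : spaceForm o) :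
    TangentSpace (𝓡 N) p →L[ℝ] TangentSpace (𝓡 N) p →L[ℝ] ℝ :=
  pullForm (flatMetric N ν)
    (mvfderiv (𝓡 N) (fun q : spaceForm o => ((q : Quadric N ν c) : Ambient N)) p)

/-! ### Warped products -/

section WarpedProduct

variable {E : Type*} [NormedAddCommGroup E] [NormedSpace ℝ E]
  {H : Type*} [TopologicalSpace H] (I : ModelWithCorners ℝ E H)
  {P : Type*} [TopologicalSpace P] [ChartedSpace H P]

/-- The metric `ε dt² + a(t)² g_P` on `J × P`, where `J` is an open subset of the line. -/
def warpedMetric (ε : ℤˣ) (J : TopologicalSpace.Opens ℝ) (a : ℝ → ℝ)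
    (gP : ∀ p : P, TangentSpace I p →L[ℝ] TangentSpace I p →L[ℝ] ℝ) (q : J × P) :
    TangentSpace (𝓘(ℝ, ℝ).prod I) q →L[ℝ] TangentSpace (𝓘(ℝ, ℝ).prod I) q →L[ℝ] ℝ :=
  ((ε : ℤ) : ℝ) •
      (mvfderiv (𝓘(ℝ, ℝ).prod I) (fun r : J × P => (r.1 : ℝ)) q).smulRight
        (mvfderiv (𝓘(ℝ, ℝ).prod I) (fun r : J × P => (r.1 : ℝ)) q) +
    (a q.1 ^ 2) •
      pullForm (gP q.2) (mfderiv (𝓘(ℝ, ℝ).prod I) I (Prod.snd : J × P → P) q)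

/-- The vector field `∂t` of a product `J × P`. -/
def partialT (J : TopologicalSpace.Opens ℝ) (q : J × P) :
    TangentSpace (𝓘(ℝ, ℝ).prod I) q :=
  ((1 : ℝ), (0 : E))

end WarpedProduct

/-- The metric `ε dt² + a(t)² g` of the warped product of the line (or an open subset `J` of it)
and the space form through `o`. -/
def ambientMetric (ε : ℤˣ) (J : TopologicalSpace.Opens ℝ) (a : ℝ → ℝ) (o : Quadric N ν c)
    (q : J × spaceForm o) :
    TangentSpace (𝓘(ℝ, ℝ).prod (𝓡 N)) q →L[ℝ] TangentSpace (𝓘(ℝ, ℝ).prod (𝓡 N)) q →L[ℝ] ℝ :=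
  warpedMetric (𝓡 N) ε J a (spaceFormMetric o) q

/-! ### Semi-Riemannian metrics and Levi-Civita connections -/

section Metric

variable {E : Type*} [NormedAddCommGroup E] [NormedSpace ℝ E] [FiniteDimensional ℝ E]
  {H : Type*} [TopologicalSpace H] (I : ModelWithCorners ℝ E H)
  (M : Type*) [TopologicalSpace M] [ChartedSpace H M] [IsManifold I ∞ M]

/-- A smooth semi-Riemannian metric on `M`: a smooth field of nondegenerate symmetric bilinear
forms on the tangent spaces. -/
structure SemiRiemannianMetric where
  inner : ∀ x : M, TangentSpace I x →L[ℝ] TangentSpace I x →L[ℝ] ℝ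
  symm : ∀ (x : M) (v w : TangentSpace I x), inner x v w = inner x w v
  nondegenerate : ∀ (x : M) (v : TangentSpace I x), (∀ w, inner x v w = 0) → v = 0
  contMDiff : ContMDiff I (I.prod 𝓘(ℝ, E →L[ℝ] E →L[ℝ] ℝ)) ∞
    (fun x => Bundle.TotalSpace.mk' (E →L[ℝ] E →L[ℝ] ℝ)
      (E := fun x : M => TangentSpace I x →L[ℝ] TangentSpace I x →L[ℝ] ℝ) x (inner x))

variable {I M}

/-- For a covector `φ`, there is exactly one tangent vector `u` with `⟨u, v⟩ = φ v` for all
`v`. -/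
theorem SemiRiemannianMetric.existsUnique_sharp (g : SemiRiemannianMetric I M) (x : M)
    (φ : TangentSpace I x →L[ℝ] ℝ) : ∃! u : TangentSpace I x, ∀ v, g.inner x u v = φ v := by
  have : FiniteDimensional ℝ (TangentSpace I x) := inferInstanceAs (FiniteDimensional ℝ E)
  let B : TangentSpace I x →ₗ[ℝ] Module.Dual ℝ (TangentSpace I x) :=
    { toFun := fun u => (g.inner x u : TangentSpace I x →ₗ[ℝ] ℝ)
      map_add' := fun u v => by ext w; simp
      map_smul' := fun r v => by ext w; simp }
  have hB : Function.Injective B := by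
    rw [← LinearMap.ker_eq_bot, LinearMap.ker_eq_bot']
    intro u hu
    exact g.nondegenerate x u fun w => LinearMap.congr_fun hu w
  have hS : Function.Surjective B :=
    (LinearMap.injective_iff_surjective_of_finrank_eq_finrank
      Subspace.dual_finrank_eq.symm).1 hB
  obtain ⟨u, hu⟩ := hS (φ : TangentSpace I x →ₗ[ℝ] ℝ)
  refine ⟨u, fun v => LinearMap.congr_fun hu v, fun u' hu' => hB ?_⟩
  rw [hu]
  ext v
  exact hu' v

/-- The tangent vector metrically dual to the covector `φ`. -/
def SemiRiemannianMetric.sharp (g : SemiRiemannianMetric I M) (x : M)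
    (φ : TangentSpace I x →L[ℝ] ℝ) : TangentSpace I x :=
  (g.existsUnique_sharp x φ).choose

theorem SemiRiemannianMetric.inner_sharp (g : SemiRiemannianMetric I M) (x : M)
    (φ : TangentSpace I x →L[ℝ] ℝ) (v : TangentSpace I x) :
    g.inner x (g.sharp x φ) v = φ v :=
  (g.existsUnique_sharp x φ).choose_spec.1 v

/-- The gradient of a function, `⟨grad h, v⟩ = dh(v)`. -/
def SemiRiemannianMetric.grad (g : SemiRiemannianMetric I M) (h : M → ℝ) (x : M) :
    TangentSpace I x :=
  g.sharp x (mvfderiv I h x)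

/-- `D` is the Levi-Civita connection of the metric `g`: it is torsion-free and
`u⟨Y, Z⟩ = ⟨D_u Y, Z⟩ + ⟨Y, D_u Z⟩` for every tangent vector `u`.
(`D Y x u` is `D_u Y` at `x`.) -/
def IsLeviCivita (g : ∀ x : M, TangentSpace I x →L[ℝ] TangentSpace I x →L[ℝ] ℝ)
    (D : CovariantDerivative I E (TangentSpace I : M → Type _)) : Prop :=
  D.torsion = 0 ∧
    ∀ (x : M) (Y Z : ∀ y : M, TangentSpace I y),
      MDifferentiableAt I I.tangent (fun y => (⟨y, Y y⟩ : TangentBundle I M)) x →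
      MDifferentiableAt I I.tangent (fun y => (⟨y, Z y⟩ : TangentBundle I M)) x →
      ∀ u : TangentSpace I x,
        mvfderiv I (fun y => g y (Y y) (Z y)) x u =
          g x (D Y x u) (Z x) + g x (Y x) (D Z x u)

end Metric

/-! ### Isometric immersions -/

section Immersion

variable {E : Type*} [NormedAddCommGroup E] [NormedSpace ℝ E] [FiniteDimensional ℝ E]
  {H : Type*} [TopologicalSpace H] {I : ModelWithCorners ℝ E H}
  {M : Type*} [TopologicalSpace M] [ChartedSpace H M] [IsManifold I ∞ M]
  {F : Type*} [NormedAddCommGroup F] [NormedSpace ℝ F] [FiniteDimensional ℝ F]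
  {G : Type*} [TopologicalSpace G] {J : ModelWithCorners ℝ F G}
  {P : Type*} [TopologicalSpace P] [ChartedSpace G P] [IsManifold J ∞ P]

/-- `f` is an isometric immersion: it is smooth and `⟨df u, df v⟩ = ⟨u, v⟩`. (Since the metric of
`M` is nondegenerate, this forces every differential of `f` to be injective.) -/
def IsIsometricImmersion (g : SemiRiemannianMetric I M)
    (gP : ∀ p : P, TangentSpace J p →L[ℝ] TangentSpace J p →L[ℝ] ℝ) (f : M → P) : Prop :=
  ContMDiff I J ∞ f ∧
    ∀ (x : M) (u v : TangentSpace I x),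
      gP (f x) (mfderiv I J f x u) (mfderiv I J f x v) = g.inner x u v

/-- The covariant derivative along `f` induced by a connection `D` of `P`: for a section `W` of
`TP` along `f` it is `D_u W` at `x`. In the trivialization of `TP` at `f x`, the section `W` has
a component function `w : M → F`; the constant component `w x` defines a local vector field `S`
of `P`, and `D_u W = dw(u) + D_{df u} S`. -/
def derivAlong (D : CovariantDerivative J F (TangentSpace J : P → Type _)) (f : M → P)
    (W : ∀ y : M, TangentSpace J (f y)) (x : M) (u : TangentSpace I x) :
    TangentSpace J (f x) :=
  (trivializationAt F (TangentSpace J : P → Type _) (f x)).symm (f x)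
      (mvfderiv I (fun y =>
        (trivializationAt F (TangentSpace J : P → Type _) (f x)
          (⟨f y, W y⟩ : TangentBundle J P)).2) x u) +
    D (FiberBundle.extend F (W x)) (f x) (mfderiv I J f x u)

variable (g : SemiRiemannianMetric I M)
  (gP : ∀ p : P, TangentSpace J p →L[ℝ] TangentSpace J p →L[ℝ] ℝ)
  (D : CovariantDerivative J F (TangentSpace J : P → Type _)) (f : M → P)

/-- The component of `w ∈ T_{f x}P` tangent to `M`: the vector `u ∈ T_xM` with
`⟨u, v⟩ = ⟨w, df v⟩` for all `v ∈ T_xM`. -/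
def tangentPart (x : M) (w : TangentSpace J (f x)) : TangentSpace I x :=
  g.sharp x ((gP (f x) w).comp (mfderiv I J f x))

/-- The component of `w ∈ T_{f x}P` normal to `M`. -/
def normalPart (x : M) (w : TangentSpace J (f x)) : TangentSpace J (f x) :=
  w - mfderiv I J f x (tangentPart g gP f x w)

/-- `w ∈ T_{f x}P` is normal to `M`. -/
def IsNormal (x : M) (w : TangentSpace J (f x)) : Prop :=
  ∀ v : TangentSpace I x, gP (f x) w (mfderiv I J f x v) = 0

/-- The second fundamental form `α(u, v)`: the normal component of the derivative along `f`, in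
the direction `u`, of `df V`, where `V` is a local vector field on `M` with `V x = v`. -/
def secondFundamentalForm (x : M) (u v : TangentSpace I x) : TangentSpace J (f x) :=
  normalPart g gP f x
    (derivAlong D f (fun y => mfderiv I J f y (FiberBundle.extend E v y)) x u)

/-- The normal connection `∇^⊥_u η`. -/
def normalConnection (η : ∀ y : M, TangentSpace J (f y)) (x : M) (u : TangentSpace I x) :
    TangentSpace J (f x) :=
  normalPart g gP f x (derivAlong D f η x u)

/-- The covariant derivative of the second fundamental form, seen as the trilinear form
`(X, Z, η) ↦ ⟨α(X, Z), η⟩`: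
`(∇_Y α)(X, Z, η) = Y⟨α(X, Z), η⟩ - ⟨α(∇_Y X, Z), η⟩ - ⟨α(X, ∇_Y Z), η⟩ - ⟨α(X, Z), ∇^⊥_Y η⟩`,
where `∇` is the connection `DM` of `M`. -/
def covDerivSecondFundamentalForm
    (DM : CovariantDerivative I E (TangentSpace I : M → Type _))
    (Y X Z : ∀ y : M, TangentSpace I y) (η : ∀ y : M, TangentSpace J (f y)) (x : M) : ℝ :=
  mvfderiv I (fun y => gP (f y) (secondFundamentalForm g gP D f y (X y) (Z y)) (η y)) x (Y x) -
    gP (f x) (secondFundamentalForm g gP D f x (DM X x (Y x)) (Z x)) (η x) -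
    gP (f x) (secondFundamentalForm g gP D f x (X x) (DM Z x (Y x))) (η x) -
    gP (f x) (secondFundamentalForm g gP D f x (X x) (Z x))
      (normalConnection g gP D f η x (Y x))

end Immersion

/-! ### Submanifolds of a warped product: the vector fields `T` and `ξ` -/

section Vertical

variable {E : Type*} [NormedAddCommGroup E] [NormedSpace ℝ E] [FiniteDimensional ℝ E]
  {H : Type*} [TopologicalSpace H] {I : ModelWithCorners ℝ E H}
  {M : Type*} [TopologicalSpace M] [ChartedSpace H M] [IsManifold I ∞ M]
  {F : Type*} [NormedAddCommGroup F] [NormedSpace ℝ F]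
  {G : Type*} [TopologicalSpace G] (K : ModelWithCorners ℝ F G)
  {P : Type*} [TopologicalSpace P] [ChartedSpace G P]
  {J : TopologicalSpace.Opens ℝ}

/-- The tangent vector field `T = ε grad π`, where `π : M → J` is the first component of the
immersion `f : M → J × P`. -/
def tangentT (ε : ℤˣ) (g : SemiRiemannianMetric I M) (f : M → J × P) (x : M) :
    TangentSpace I x :=
  ((ε : ℤ) : ℝ) • g.grad (fun y => ((f y).1 : ℝ)) x

/-- The vector field `ξ = ∂t - T` along the immersion. -/
def normalXi (ε : ℤˣ) (g : SemiRiemannianMetric I M) (f : M → J × P) (x : M) :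
    TangentSpace (𝓘(ℝ, ℝ).prod K) (f x) :=
  partialT K J (f x) - mfderiv I (𝓘(ℝ, ℝ).prod K) f x (tangentT ε g f x)

end Vertical

end WarpedCodazzi

end

open WarpedCodazzi

noncomputable section

namespace WarpedCodazzi

open VectorField

section Calculus

variable {E : Type*} [NormedAddCommGroup E] [NormedSpace ℝ E]
  {H : Type*} [TopologicalSpace H] {I : ModelWithCorners ℝ E H}
  {M : Type*} [TopologicalSpace M] [ChartedSpace H M]
  {F : Type*} [NormedAddCommGroup F] [NormedSpace ℝ F]
  {F' : Type*} [NormedAddCommGroup F'] [NormedSpace ℝ F']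
  {F'' : Type*} [NormedAddCommGroup F''] [NormedSpace ℝ F'']

/-- The vector-valued function `h` is differentiable at `x` and its derivative in the direction
`u` is `h'`. -/
def HasVDeriv (I : ModelWithCorners ℝ E H) (h : M → F) (x : M) (u : TangentSpace I x)
    (h' : F) : Prop :=
  MDifferentiableAt I 𝓘(ℝ, F) h x ∧ mvfderiv I h x u = h'

variable {x : M} {u : TangentSpace I x}

theorem _root_.MDifferentiableAt.hasVDeriv {h : M → F} (hh : MDifferentiableAt I 𝓘(ℝ, F) h x)
    (u : TangentSpace I x) : HasVDeriv I h x u (mvfderiv I h x u) :=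
  ⟨hh, rfl⟩

theorem HasVDeriv.unique {h : M → F} {h₁ h₂ : F} (H₁ : HasVDeriv I h x u h₁)
    (H₂ : HasVDeriv I h x u h₂) : h₁ = h₂ :=
  H₁.2.symm.trans H₂.2

theorem HasVDeriv.congr_of_eventuallyEq {h k : M → F} {h' : F} (hh : HasVDeriv I h x u h')
    (hk : k =ᶠ[𝓝 x] h) : HasVDeriv I k x u h' := by
  refine ⟨hh.1.congr_of_eventuallyEq hk, ?_⟩
  rw [← hh.2]
  have : mfderiv I 𝓘(ℝ, F) k x = mfderiv I 𝓘(ℝ, F) h x := hk.mfderiv_eq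
  exact DFunLike.congr_fun this u

theorem hasVDeriv_const (v : F) (x : M) (u : TangentSpace I x) :
    HasVDeriv I (fun _ : M => v) x u 0 :=
  ⟨mdifferentiableAt_const, by rw [mvfderiv_const]; rfl⟩

theorem HasVDeriv.comp_hasFDerivAt {h : M → F} {h' : F} {φ : F → F'} {φ' : F →L[ℝ] F'}
    (hφ : HasFDerivAt φ φ' (h x)) (hh : HasVDeriv I h x u h') :
    HasVDeriv I (fun y => φ (h y)) x u (φ' h') := by
  have h1 := hφ.hasMFDerivAt.comp x hh.1.hasMFDerivAt
  refine ⟨h1.mdifferentiableAt, ?_⟩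
  rw [← hh.2]
  exact DFunLike.congr_fun h1.mfderiv u

theorem HasVDeriv.prodMk {h : M → F} {h' : F} {k : M → F'} {k' : F'}
    (hh : HasVDeriv I h x u h') (hk : HasVDeriv I k x u k') :
    HasVDeriv I (fun y => (h y, k y)) x u (h', k') := by
  refine ⟨hh.1.prodMk_space hk.1, ?_⟩
  rw [← hh.2, ← hk.2]
  have h1 : HasMFDerivAt I 𝓘(ℝ, F × F') (fun y => (h y, k y)) x
      ((mfderiv I 𝓘(ℝ, F) h x : E →L[ℝ] F).prod (mfderiv I 𝓘(ℝ, F') k x : E →L[ℝ] F')) :=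
    ⟨ContinuousAt.prodMk hh.1.continuousAt hk.1.continuousAt, hh.1.hasMFDerivAt.2.prodMk hk.1.hasMFDerivAt.2⟩
  exact DFunLike.congr_fun h1.mfderiv u

theorem HasVDeriv.fst {h : M → F × F'} {h' : F × F'} (hh : HasVDeriv I h x u h') :
    HasVDeriv I (fun y => (h y).1) x u h'.1 :=
  HasVDeriv.comp_hasFDerivAt (φ := Prod.fst) hasFDerivAt_fst hh

theorem HasVDeriv.snd {h : M → F × F'} {h' : F × F'} (hh : HasVDeriv I h x u h') :
    HasVDeriv I (fun y => (h y).2) x u h'.2 :=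
  HasVDeriv.comp_hasFDerivAt (φ := Prod.snd) hasFDerivAt_snd hh

theorem HasVDeriv.bilin (B : F →L[ℝ] F' →L[ℝ] F'') {h : M → F} {h' : F} {k : M → F'} {k' : F'}
    (hh : HasVDeriv I h x u h') (hk : HasVDeriv I k x u k') :
    HasVDeriv I (fun y => B (h y) (k y)) x u (B (h x) k' + B h' (k x)) := by
  have h1 := B.isBoundedBilinearMap.hasFDerivAt (h x, k x)
  simpa using HasVDeriv.comp_hasFDerivAt (h := fun y => (h y, k y))
    (φ := fun q : F × F' => B q.1 q.2) h1 (hh.prodMk hk)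

theorem HasVDeriv.smul {h : M → ℝ} {h' : ℝ} {k : M → F} {k' : F}
    (hh : HasVDeriv I h x u h') (hk : HasVDeriv I k x u k') :
    HasVDeriv I (fun y => h y • k y) x u (h x • k' + h' • k x) :=
  HasVDeriv.bilin (ContinuousLinearMap.lsmul ℝ ℝ) hh hk

theorem HasVDeriv.mul {h : M → ℝ} {h' : ℝ} {k : M → ℝ} {k' : ℝ}
    (hh : HasVDeriv I h x u h') (hk : HasVDeriv I k x u k') :
    HasVDeriv I (fun y => h y * k y) x u (h x * k' + h' * k x) :=
  hh.smul hk

theorem HasVDeriv.add {h k : M → F} {h' k' : F}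
    (hh : HasVDeriv I h x u h') (hk : HasVDeriv I k x u k') :
    HasVDeriv I (fun y => h y + k y) x u (h' + k') :=
  ⟨hh.1.add hk.1, by rw [mvfderiv_fun_add hh.1 hk.1, ← hh.2, ← hk.2]; rfl⟩

theorem HasVDeriv.const_mul (r : ℝ) {h : M → ℝ} {h' : ℝ} (hh : HasVDeriv I h x u h') :
    HasVDeriv I (fun y => r * h y) x u (r * h') := by
  simpa using (hasVDeriv_const r x u).mul hh

theorem HasVDeriv.sum {ι : Type*} (s : Finset ι) {h : ι → M → F} {h' : ι → F}
    (hh : ∀ i ∈ s, HasVDeriv I (h i) x u (h' i)) :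
    HasVDeriv I (fun y => ∑ i ∈ s, h i y) x u (∑ i ∈ s, h' i) := by
  classical
  induction s using Finset.induction_on with
  | empty => simpa using hasVDeriv_const (0 : F) x u
  | insert i s hi ih =>
    simp only [Finset.sum_insert hi]
    exact (hh i (by simp)).add (ih fun j hj => hh j (by simp [hj]))

theorem HasVDeriv.comp_hasDerivAt {h : M → ℝ} {h' : ℝ} {φ : ℝ → ℝ} {φ' : ℝ}
    (hφ : HasDerivAt φ φ' (h x)) (hh : HasVDeriv I h x u h') :
    HasVDeriv I (fun y => φ (h y)) x u (φ' * h') := by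
  simpa [mul_comm] using HasVDeriv.comp_hasFDerivAt hφ.hasFDerivAt hh

end Calculus

section Bracket

variable {E : Type*} [NormedAddCommGroup E] [NormedSpace ℝ E]
  {H : Type*} [TopologicalSpace H] {I : ModelWithCorners ℝ E H} [I.Boundaryless]
  {M : Type*} [TopologicalSpace M] [ChartedSpace H M] [IsManifold I ∞ M]
  {F : Type*} [NormedAddCommGroup F] [NormedSpace ℝ F]

/-- The vector field `V`, read in the preferred chart at `x`. -/
def chartField (x : M) (V : ∀ y : M, TangentSpace I y) : E → E :=
  mpullbackWithin 𝓘(ℝ, E) I (extChartAt I x).symm V (range I)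

theorem fderiv_comp_extChartAt_symm {h : M → F} (V : ∀ y : M, TangentSpace I y) {x : M} {z : E}
    (hz : z ∈ (extChartAt I x).target)
    (hh : MDifferentiableAt I 𝓘(ℝ, F) h ((extChartAt I x).symm z)) :
    DifferentiableAt ℝ (h ∘ (extChartAt I x).symm) z ∧
    fderiv ℝ (h ∘ (extChartAt I x).symm) z
        (chartField x V z) =
      (fun y => mvfderiv I h y (V y)) ((extChartAt I x).symm z) := by
  have : IsManifold I 1 M := .of_le (n := ∞) (by simp)
  have hr : range I = univ := I.range_eq_univ
  have hs : MDifferentiableAt 𝓘(ℝ, E) I (extChartAt I x).symm z := by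
    have := mdifferentiableWithinAt_extChartAt_symm hz
    rwa [hr, mdifferentiableWithinAt_univ] at this
  have hinv := isInvertible_mfderivWithin_extChartAt_symm hz
  refine ⟨(hh.comp z hs).differentiableAt, ?_⟩
  have h1 := mfderiv_comp z hh hs
  rw [mfderiv_eq_fderiv] at h1
  have h2 : (mfderiv 𝓘(ℝ, E) I (extChartAt I x).symm z)
      (mpullbackWithin 𝓘(ℝ, E) I (extChartAt I x).symm V (range I) z) =
      V ((extChartAt I x).symm z) := by
    rw [mpullbackWithin_apply]
    rw [hr, mfderivWithin_univ] at hinv ⊢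
    exact hinv.self_apply_inverse _
  have h3 := DFunLike.congr_fun h1
    (mpullbackWithin 𝓘(ℝ, E) I (extChartAt I x).symm V (range I) z)
  refine h3.trans ?_
  change mfderiv I 𝓘(ℝ, F) h _ (mfderiv 𝓘(ℝ, E) I (extChartAt I x).symm z _) = _
  rw [h2]
  rfl

theorem mdifferentiableAt_mvfderiv_apply_and_bracket [CompleteSpace E] {h : M → F} {x : M}
    (hh : ContMDiffAt I 𝓘(ℝ, F) 2 h x) {U V : ∀ y : M, TangentSpace I y}
    (hU : MDifferentiableAt I I.tangent (fun y => (⟨y, U y⟩ : TangentBundle I M)) x)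
    (hV : MDifferentiableAt I I.tangent (fun y => (⟨y, V y⟩ : TangentBundle I M)) x) :
    MDifferentiableAt I 𝓘(ℝ, F) (fun y => mvfderiv I h y (V y)) x ∧
    mvfderiv I (fun y => mvfderiv I h y (V y)) x (U x) -
        mvfderiv I (fun y => mvfderiv I h y (U y)) x (V x) =
      mvfderiv I h x (mlieBracket I U V x) := by
  have : IsManifold I 1 M := .of_le (n := ∞) (by simp)
  have : IsManifold I 2 M := .of_le (n := ∞) ENat.LEInfty.out
  have hr : range I = univ := I.range_eq_univ
  set φ := extChartAt I x with hφ
  have hx : φ.symm (φ x) = x := extChartAt_to_inv x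
  have hxt : φ x ∈ φ.target := mem_extChartAt_target x
  have hdiff : ∀ᶠ y in 𝓝 x, MDifferentiableAt I 𝓘(ℝ, F) h y := by
    filter_upwards [(contMDiffAt_iff_contMDiffAt_nhds (by simp)).1 hh] with y hy
    exact hy.mdifferentiableAt (by simp)
  have hsymm : ContinuousAt φ.symm (φ x) := continuousAt_extChartAt_symm x
  have htarget : ∀ᶠ z in 𝓝 (φ x), z ∈ φ.target := by
    exact extChartAt_target_mem_nhds x
  have hk : ContDiffAt ℝ 2 (h ∘ φ.symm) (φ x) := by
    have h1 := (contMDiffAt_iff.1 hh).2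
    rw [hr, contDiffWithinAt_univ] at h1
    exact h1
  have pull : ∀ (W : ∀ y : M, TangentSpace I y),
      MDifferentiableAt I I.tangent (fun y => (⟨y, W y⟩ : TangentBundle I M)) x →
      DifferentiableAt ℝ
        (chartField x W) (φ x) := by
    intro W hW
    unfold chartField
    have h1 := MDifferentiableWithinAt.differentiableWithinAt_mpullbackWithin_vectorField
      (mdifferentiableWithinAt_univ.2 hW)
    rw [hr] at h1 ⊢
    simp only [preimage_univ, univ_inter] at h1
    exact differentiableWithinAt_univ.1 h1
  have hder : ∀ (W : ∀ y : M, TangentSpace I y),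
      MDifferentiableAt I I.tangent (fun y => (⟨y, W y⟩ : TangentBundle I M)) x →
      MDifferentiableAt I 𝓘(ℝ, F) (fun y => mvfderiv I h y (W y)) x ∧
      ∀ (W' : ∀ y : M, TangentSpace I y),
        mvfderiv I (fun y => mvfderiv I h y (W y)) x (W' x) =
          fderiv ℝ (fun z => fderiv ℝ (h ∘ φ.symm) z
            ((chartField x W) z)) (φ x)
            ((chartField x W') (φ x)) := by
    intro W hW
    have e1 : (fun y => mvfderiv I h y (W y)) ∘ φ.symm =ᶠ[𝓝 (φ x)]
        fun z => fderiv ℝ (h ∘ φ.symm) z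
          ((chartField x W) z) := by
      have h2 : ∀ᶠ z in 𝓝 (φ x), MDifferentiableAt I 𝓘(ℝ, F) h (φ.symm z) :=
        hsymm.eventually (by rwa [hx])
      filter_upwards [h2, htarget] with z hz hzt
      exact (fderiv_comp_extChartAt_symm W hzt hz).2.symm
    have d1 : DifferentiableAt ℝ ((fun y => mvfderiv I h y (W y)) ∘ φ.symm) (φ x) := by
      refine DifferentiableAt.congr_of_eventuallyEq ?_ e1
      exact ((hk.fderiv_right (m := 1) (by norm_num)).differentiableAt (by simp)).clm_apply
        (pull W hW)
    have d2 : MDifferentiableAt I 𝓘(ℝ, F) (fun y => mvfderiv I h y (W y)) x := by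
      have d3 : MDifferentiableAt I 𝓘(ℝ, F)
          (((fun y => mvfderiv I h y (W y)) ∘ φ.symm) ∘ φ) x :=
        d1.mdifferentiableAt.comp x (mdifferentiableAt_extChartAt (mem_chart_source H x))
      refine d3.congr_of_eventuallyEq ?_
      filter_upwards [extChartAt_source_mem_nhds (I := I) x] with y hy
      simp only [Function.comp_apply]
      rw [φ.left_inv hy]
    refine ⟨d2, fun W' => ?_⟩
    have h4 := (fderiv_comp_extChartAt_symm (h := fun y => mvfderiv I h y (W y)) W' hxt
      (by rw [← hφ, hx]; exact d2)).2
    rw [← hφ, hx] at h4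
    exact h4.symm.trans (by rw [e1.fderiv_eq])
  refine ⟨(hder V hV).1, ?_⟩
  rw [(hder V hV).2 U, (hder U hU).2 V]
  have hfd : DifferentiableAt ℝ (fderiv ℝ (h ∘ φ.symm)) (φ x) :=
    (hk.fderiv_right (m := 1) (by norm_num)).differentiableAt (by simp)
  have hbr : mvfderiv I h x (mlieBracket I U V x) = fderiv ℝ (h ∘ φ.symm) (φ x)
      (lieBracket ℝ (chartField x U)
        (chartField x V) (φ x)) := by
    have e2 : h =ᶠ[𝓝 x] (h ∘ φ.symm) ∘ φ := by
      filter_upwards [extChartAt_source_mem_nhds (I := I) x] with y hy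
      simp only [Function.comp_apply]
      rw [φ.left_inv hy]
    have hφd : MDifferentiableAt I 𝓘(ℝ, E) φ x :=
      mdifferentiableAt_extChartAt (mem_chart_source H x)
    have h5 : mfderiv I 𝓘(ℝ, F) h x =
        (fderiv ℝ (h ∘ φ.symm) (φ x) : E →L[ℝ] F).comp (mfderiv I 𝓘(ℝ, E) φ x) := by
      rw [e2.mfderiv_eq, ← mfderiv_eq_fderiv]
      exact mfderiv_comp x (hk.differentiableAt (by simp)).mdifferentiableAt hφd
    have hinv : (mfderiv I 𝓘(ℝ, E) φ x).IsInvertible :=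
      isInvertible_mfderiv_extChartAt (mem_extChartAt_source x)
    rw [← mlieBracketWithin_univ, mlieBracketWithin_apply, preimage_univ, univ_inter]
    have h6 := DFunLike.congr_fun h5 ((mfderiv I 𝓘(ℝ, E) φ x).inverse
      (lieBracketWithin (E := E) ℝ (chartField x U)
        (chartField x V) (range I) (φ x)))
    refine h6.trans ?_
    rw [hr, lieBracketWithin_univ]
    exact congrArg _ (hinv.self_apply_inverse _)
  rw [hbr]
  have hsy := hk.isSymmSndFDerivAt (by simp)
  have hU' := pull U hU
  have hV' := pull V hV
  rw [fderiv_clm_apply hfd hV', fderiv_clm_apply hfd hU']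
  simp only [lieBracket, add_apply, ContinuousLinearMap.comp_apply,
    ContinuousLinearMap.flip_apply, map_sub]
  rw [hsy.eq]
  abel

theorem mvfderiv_mvfderiv_apply_sub [CompleteSpace E] {h : M → F} {x : M}
    (hh : ContMDiffAt I 𝓘(ℝ, F) 2 h x) {U V : ∀ y : M, TangentSpace I y}
    (hU : MDifferentiableAt I I.tangent (fun y => (⟨y, U y⟩ : TangentBundle I M)) x)
    (hV : MDifferentiableAt I I.tangent (fun y => (⟨y, V y⟩ : TangentBundle I M)) x) :
    mvfderiv I (fun y => mvfderiv I h y (V y)) x (U x) -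
        mvfderiv I (fun y => mvfderiv I h y (U y)) x (V x) =
      mvfderiv I h x (mlieBracket I U V x) :=
  (mdifferentiableAt_mvfderiv_apply_and_bracket hh hU hV).2

end Bracket

section TangentMap

variable {E : Type*} [NormedAddCommGroup E] [NormedSpace ℝ E]
  {H : Type*} [TopologicalSpace H] {I : ModelWithCorners ℝ E H}
  {M : Type*} [TopologicalSpace M] [ChartedSpace H M]
  {G : Type*} [NormedAddCommGroup G] [NormedSpace ℝ G]
  {K : Type*} [TopologicalSpace K] {J : ModelWithCorners ℝ G K}
  {P : Type*} [TopologicalSpace P] [ChartedSpace K P] [IsManifold J ∞ P]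
  {F : Type*} [NormedAddCommGroup F] [NormedSpace ℝ F]

theorem contMDiff_mvfderiv_tangentBundle {h : P → F} (hh : ContMDiff J 𝓘(ℝ, F) ∞ h) :
    ContMDiff J.tangent 𝓘(ℝ, F) ∞ (fun v : TangentBundle J P => mvfderiv J h v.1 v.2) := by
  have : IsManifold J 1 P := .of_le (n := ∞) (by simp)
  exact (contMDiff_snd_tangentBundle_modelSpace F 𝓘(ℝ, F)).comp
    (hh.contMDiff_tangentMap (m := ∞) (by simp))

end TangentMap

section Christoffel

variable {N : ℕ} (ε c : ℝ) (ν : ℕ) (a : ℝ → ℝ)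

/-- The form `ε dt² + a(t)² g₀` at the point `q = (t, p)` of `ℝ × ℝ^{N+1}`. -/
def warpForm (q v w : ℝ × Ambient N) : ℝ :=
  ε * (v.1 * w.1) + a q.1 ^ 2 * flatMetric N ν v.2 w.2

/-- The Christoffel map of the warped product, seen as a submanifold of `ℝ × ℝ^{N+1}`. -/
def christoffel (q v w : ℝ × Ambient N) : ℝ × Ambient N :=
  (-(ε * (a q.1 * deriv a q.1) * flatMetric N ν v.2 w.2),
    (deriv a q.1 / a q.1) • (v.1 • w.2 + w.1 • v.2) + (c * flatMetric N ν v.2 w.2) • q.2)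

theorem warpForm_comm (q v w : ℝ × Ambient N) :
    warpForm ε ν a q v w = warpForm ε ν a q w v := by
  simp only [warpForm, flatMetric_symm N ν v.2 w.2]
  ring

theorem warpForm_add_left (q v v' w : ℝ × Ambient N) :
    warpForm ε ν a q (v + v') w = warpForm ε ν a q v w + warpForm ε ν a q v' w := by
  simp only [warpForm, Prod.fst_add, Prod.snd_add, map_add, add_apply]
  ring

theorem warpForm_sub_left (q v v' w : ℝ × Ambient N) :
    warpForm ε ν a q (v - v') w = warpForm ε ν a q v w - warpForm ε ν a q v' w := by
  simp only [warpForm, Prod.fst_sub, Prod.snd_sub, map_sub, sub_apply]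
  ring

theorem christoffel_comm (q v w : ℝ × Ambient N) :
    christoffel ε c ν a q v w = christoffel ε c ν a q w v := by
  simp only [christoffel, flatMetric_symm N ν v.2 w.2, add_comm (v.1 • w.2)]

theorem christoffel_add_right (q v w w' : ℝ × Ambient N) :
    christoffel ε c ν a q v (w + w') = christoffel ε c ν a q v w + christoffel ε c ν a q v w' := by
  ext1
  · simp only [christoffel, Prod.fst_add, Prod.snd_add, map_add]
    ring
  · simp only [christoffel, Prod.fst_add, Prod.snd_add, map_add]
    module

theorem christoffel_sub_right (q v w w' : ℝ × Ambient N) :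
    christoffel ε c ν a q v (w - w') = christoffel ε c ν a q v w - christoffel ε c ν a q v w' := by
  rw [eq_sub_iff_add_eq, ← christoffel_add_right, sub_add_cancel]

end Christoffel

section Along

variable {E : Type*} [NormedAddCommGroup E] [NormedSpace ℝ E]
  {H : Type*} [TopologicalSpace H] (I : ModelWithCorners ℝ E H)
  {M : Type*} [TopologicalSpace M] [ChartedSpace H M]
  {N : ℕ} (ε c : ℝ) (ν : ℕ) (a : ℝ → ℝ)

/-- The covariant derivative, in the direction `u`, of the field `W` along a map `Φ` to the warped
product, seen as a submanifold of `ℝ × ℝ^{N+1}`. -/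
def warpDeriv (Φ W : M → ℝ × Ambient N) (x : M) (u : TangentSpace I x) : ℝ × Ambient N :=
  mvfderiv I W x u + christoffel ε c ν a (Φ x) (mvfderiv I Φ x u) (W x)

variable {I ε c ν a} {x : M} {u : TangentSpace I x}

theorem HasVDeriv.flatMetric {h k : M → Ambient N} {h' k' : Ambient N}
    (hh : HasVDeriv I h x u h') (hk : HasVDeriv I k x u k') :
    HasVDeriv I (fun y => flatMetric N ν (h y) (k y)) x u
      (WarpedCodazzi.flatMetric N ν (h x) k' + WarpedCodazzi.flatMetric N ν h' (k x)) :=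
  hh.bilin _ hk

theorem flatMetric_mvfderiv_eq_zero {Φ : M → ℝ × Ambient N}
    (hΦ : MDifferentiableAt I 𝓘(ℝ, ℝ × Ambient N) Φ x)
    (hc : ∀ y, flatMetric N ν (Φ y).2 (Φ y).2 = c) :
    flatMetric N ν (Φ x).2 (mvfderiv I Φ x u).2 = 0 := by
  have h1 := (hΦ.hasVDeriv u).snd.flatMetric (ν := ν) (hΦ.hasVDeriv u).snd
  have h2 := h1.unique ((hasVDeriv_const c x u).congr_of_eventuallyEq
    (Filter.Eventually.of_forall hc))
  rw [flatMetric_symm N ν (mvfderiv I Φ x u).2] at h2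
  linarith

theorem flatMetric_warpDeriv_eq_zero {Φ W : M → ℝ × Ambient N} (hcc : c * c = 1)
    (hΦ : MDifferentiableAt I 𝓘(ℝ, ℝ × Ambient N) Φ x)
    (hW : MDifferentiableAt I 𝓘(ℝ, ℝ × Ambient N) W x)
    (hc : ∀ y, flatMetric N ν (Φ y).2 (Φ y).2 = c)
    (hp : ∀ᶠ y in 𝓝 x, flatMetric N ν (Φ y).2 (W y).2 = 0) :
    flatMetric N ν (Φ x).2 (warpDeriv I ε c ν a Φ W x u).2 = 0 := by
  have h0 := flatMetric_mvfderiv_eq_zero (u := u) hΦ hc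
  have h1 := (hΦ.hasVDeriv u).snd.flatMetric (ν := ν) (hW.hasVDeriv u).snd
  have h2 := h1.unique ((hasVDeriv_const 0 x u).congr_of_eventuallyEq hp)
  simp only [warpDeriv, christoffel, Prod.snd_add, map_add, map_smul, smul_eq_mul, h0, hc x,
    hp.self_of_nhds]
  linear_combination h2 + flatMetric N ν (mvfderiv I Φ x u).2 (W x).2 * hcc

theorem hasVDeriv_warpForm {Φ V W : M → ℝ × Ambient N} (hε : ε * ε = 1)
    (ha : DifferentiableAt ℝ a (Φ x).1) (ha0 : a (Φ x).1 ≠ 0)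
    (hΦ : MDifferentiableAt I 𝓘(ℝ, ℝ × Ambient N) Φ x)
    (hV : MDifferentiableAt I 𝓘(ℝ, ℝ × Ambient N) V x)
    (hW : MDifferentiableAt I 𝓘(ℝ, ℝ × Ambient N) W x)
    (hpV : flatMetric N ν (Φ x).2 (V x).2 = 0) (hpW : flatMetric N ν (Φ x).2 (W x).2 = 0) :
    HasVDeriv I (fun y => warpForm ε ν a (Φ y) (V y) (W y)) x u
      (warpForm ε ν a (Φ x) (warpDeriv I ε c ν a Φ V x u) (W x) +
        warpForm ε ν a (Φ x) (V x) (warpDeriv I ε c ν a Φ W x u)) := by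
  have dΦ := hΦ.hasVDeriv u
  have dV := hV.hasVDeriv u
  have dW := hW.hasVDeriv u
  have dA := HasVDeriv.comp_hasDerivAt (h := fun y => (Φ y).1) ha.hasDerivAt dΦ.fst
  have key := ((dV.fst.mul dW.fst).const_mul ε).add
    ((dA.mul dA).mul (dV.snd.flatMetric (ν := ν) dW.snd))
  refine ⟨(key.congr_of_eventuallyEq (Filter.Eventually.of_forall fun y => ?_)).1,
    (key.congr_of_eventuallyEq (Filter.Eventually.of_forall fun y => ?_)).2.trans ?_⟩
  · simp only [warpForm]; ring
  · simp only [warpForm]; ring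
  obtain ⟨b, hb⟩ : ∃ b, deriv a (Φ x).1 / a (Φ x).1 = b := ⟨_, rfl⟩
  have hb' : deriv a (Φ x).1 = b * a (Φ x).1 := by rw [← hb]; field_simp
  have hpV' : flatMetric N ν (V x).2 (Φ x).2 = 0 := by rw [flatMetric_symm, hpV]
  have s1 := flatMetric_symm N ν (V x).2 (mvfderiv I Φ x u).2
  simp only [warpForm, warpDeriv, christoffel, Prod.fst_add, Prod.snd_add, map_add, map_smul,
    add_apply, smul_apply, smul_eq_mul, hb, hpV', hpW]
  rw [hb', s1]
  linear_combination (b * a (Φ x).1 ^ 2 *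
    (flatMetric N ν (mvfderiv I Φ x u).2 (V x).2 * (W x).1 +
      flatMetric N ν (mvfderiv I Φ x u).2 (W x).2 * (V x).1)) * hε

theorem hasVDeriv_christoffel {Φ V W : M → ℝ × Ambient N} {q' v' w' : ℝ × Ambient N} {b' : ℝ}
    (ha : DifferentiableAt ℝ a (Φ x).1) (ha' : DifferentiableAt ℝ (deriv a) (Φ x).1)
    (hb : HasDerivAt (fun t => deriv a t / a t) b' (Φ x).1)
    (hΦ : HasVDeriv I Φ x u q') (hV : HasVDeriv I V x u v') (hW : HasVDeriv I W x u w') :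
    HasVDeriv I (fun y => christoffel ε c ν a (Φ y) (V y) (W y)) x u
      (-(ε * ((deriv a (Φ x).1 ^ 2 + a (Φ x).1 * deriv (deriv a) (Φ x).1) * q'.1 *
            flatMetric N ν (V x).2 (W x).2 + a (Φ x).1 * deriv a (Φ x).1 *
          (flatMetric N ν (V x).2 w'.2 + flatMetric N ν v'.2 (W x).2))),
        (b' * q'.1) • ((V x).1 • (W x).2 + (W x).1 • (V x).2) +
          (deriv a (Φ x).1 / a (Φ x).1) •
            (v'.1 • (W x).2 + (V x).1 • w'.2 + w'.1 • (V x).2 + (W x).1 • v'.2) +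
          (c * (flatMetric N ν (V x).2 w'.2 + flatMetric N ν v'.2 (W x).2)) • (Φ x).2 +
          (c * flatMetric N ν (V x).2 (W x).2) • q'.2) := by
  have dA := HasVDeriv.comp_hasDerivAt (h := fun y => (Φ y).1) ha.hasDerivAt hΦ.fst
  have dA' := HasVDeriv.comp_hasDerivAt (h := fun y => (Φ y).1) ha'.hasDerivAt hΦ.fst
  have dB := HasVDeriv.comp_hasDerivAt (h := fun y => (Φ y).1) hb hΦ.fst
  have dF := hV.snd.flatMetric (ν := ν) hW.snd
  have k1 := ((dA.mul dA').mul dF).const_mul (-ε)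
  have k2 := (dB.smul ((hV.fst.smul hW.snd).add (hW.fst.smul hV.snd))).add
    ((dF.const_mul c).smul hΦ.snd)
  have key := k1.prodMk k2
  refine ⟨(key.congr_of_eventuallyEq (Filter.Eventually.of_forall fun y => ?_)).1,
    (key.congr_of_eventuallyEq (Filter.Eventually.of_forall fun y => ?_)).2.trans ?_⟩
  · simp only [christoffel]
    congr 1
    ring
  · simp only [christoffel]
    congr 1
    ring
  · ext1
    · simp only
      ring
    · simp only
      module

theorem differentiableAt_warp {J : Set ℝ} (hJ : IsOpen J) (ha : ContDiffOn ℝ ∞ a J) {t : ℝ}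
    (ht : t ∈ J) : DifferentiableAt ℝ a t ∧ DifferentiableAt ℝ (deriv a) t := by
  have h1 : ContDiffAt ℝ ∞ a t := ha.contDiffAt (hJ.mem_nhds ht)
  refine ⟨h1.differentiableAt (by simp), ?_⟩
  have h2 := (ha.deriv_of_isOpen (m := ∞) hJ (by simp)).contDiffAt (hJ.mem_nhds ht)
  exact h2.differentiableAt (by simp)

end Along

section LeviCivita

variable {E : Type*} [NormedAddCommGroup E] [NormedSpace ℝ E] [FiniteDimensional ℝ E]
  {H : Type*} [TopologicalSpace H] {I : ModelWithCorners ℝ E H} [I.Boundaryless]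
  {M : Type*} [TopologicalSpace M] [ChartedSpace H M] [IsManifold I ∞ M]
  {N : ℕ} {ε c : ℝ} {ν : ℕ} {a : ℝ → ℝ} {Φ : M → ℝ × Ambient N}

theorem warpDeriv_mvfderiv_sub (hΦ : ContMDiff I 𝓘(ℝ, ℝ × Ambient N) ∞ Φ) {x : M}
    {U V : ∀ y : M, TangentSpace I y}
    (hU : MDifferentiableAt I I.tangent (fun y => (⟨y, U y⟩ : TangentBundle I M)) x)
    (hV : MDifferentiableAt I I.tangent (fun y => (⟨y, V y⟩ : TangentBundle I M)) x) :
    warpDeriv I ε c ν a Φ (fun y => mvfderiv I Φ y (V y)) x (U x) -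
        warpDeriv I ε c ν a Φ (fun y => mvfderiv I Φ y (U y)) x (V x) =
      mvfderiv I Φ x (mlieBracket I U V x) := by
  have : CompleteSpace E := FiniteDimensional.complete ℝ E
  rw [← mvfderiv_mvfderiv_apply_sub ((hΦ x).of_le (ENat.LEInfty.out)) hU hV]
  simp only [warpDeriv]
  rw [christoffel_comm ε c ν a (Φ x) (mvfderiv I Φ x (U x))]
  abel

/-- A connection that is Levi-Civita for the form pulled back by `Φ` is the tangential part of the
ambient derivative. -/
theorem warpForm_warpDeriv_eq (hε : ε * ε = 1)
    (hΦ : ContMDiff I 𝓘(ℝ, ℝ × Ambient N) ∞ Φ)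
    (hc : ∀ y, flatMetric N ν (Φ y).2 (Φ y).2 = c)
    {G : ∀ x : M, TangentSpace I x →L[ℝ] TangentSpace I x →L[ℝ] ℝ}
    (hG : ∀ x u v, G x u v = warpForm ε ν a (Φ x) (mvfderiv I Φ x u) (mvfderiv I Φ x v))
    {D : CovariantDerivative I E (TangentSpace I : M → Type _)} (hD : IsLeviCivita G D)
    {x : M} (ha : DifferentiableAt ℝ a (Φ x).1) (ha0 : a (Φ x).1 ≠ 0)
    {V : ∀ y : M, TangentSpace I y}
    (hV : MDifferentiableAt I I.tangent (fun y => (⟨y, V y⟩ : TangentBundle I M)) x)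
    (u w : TangentSpace I x) :
    warpForm ε ν a (Φ x) (warpDeriv I ε c ν a Φ (fun y => mvfderiv I Φ y (V y)) x u)
      (mvfderiv I Φ x w) = G x (D V x u) w := by
  have : CompleteSpace E := FiniteDimensional.complete ℝ E
  have : IsManifold I 2 M := .of_le (n := ∞) ENat.LEInfty.out
  obtain ⟨htor, hmet⟩ := hD
  rw [D.torsion_eq_zero_iff] at htor
  have hperp : ∀ v : TangentSpace I x,
      flatMetric N ν (Φ x).2 (mvfderiv I Φ x v).2 = 0 := fun v =>
    flatMetric_mvfderiv_eq_zero ((hΦ x).mdifferentiableAt (by simp)) hc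
  have hdiff : ∀ W : ∀ y : M, TangentSpace I y,
      MDifferentiableAt I I.tangent (fun y => (⟨y, W y⟩ : TangentBundle I M)) x →
      MDifferentiableAt I 𝓘(ℝ, ℝ × Ambient N) (fun y => mvfderiv I Φ y (W y)) x := fun W hW =>
    (mdifferentiableAt_mvfderiv_apply_and_bracket ((hΦ x).of_le (ENat.LEInfty.out)) hW hW).1
  let S : Type _ := {W : ∀ y : M, TangentSpace I y //
    MDifferentiableAt I I.tangent (fun y => (⟨y, W y⟩ : TangentBundle I M)) x}
  let T : S → S → S → ℝ := fun A B C =>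
    warpForm ε ν a (Φ x) (warpDeriv I ε c ν a Φ (fun y => mvfderiv I Φ y (B.1 y)) x (A.1 x))
      (mvfderiv I Φ x (C.1 x)) - G x (D B.1 x (A.1 x)) (C.1 x)
  have T1 : ∀ A B C, T A B C = T B A C := by
    intro A B C
    have h1 := warpDeriv_mvfderiv_sub (ε := ε) (c := c) (ν := ν) (a := a) hΦ A.2 B.2
    have h2 := htor A.2 B.2
    rw [sub_eq_iff_eq_add] at h1 h2
    simp only [T]
    rw [h1, h2, warpForm_add_left, map_add, add_apply, hG x (mlieBracket I A.1 B.1 x)]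
    ring
  have T2 : ∀ A B C, T A B C = -T A C B := by
    intro A B C
    have h1 := hmet x B.1 C.1 B.2 C.2 (A.1 x)
    have h2 := (hasVDeriv_warpForm (c := c) (u := A.1 x) hε ha ha0
      ((hΦ x).mdifferentiableAt (by simp)) (hdiff _ B.2) (hdiff _ C.2) (hperp _) (hperp _)).2
    simp only [hG _ (B.1 _) (C.1 _)] at h1
    rw [h2] at h1
    have h3 : G x (B.1 x) (D C.1 x (A.1 x)) = G x (D C.1 x (A.1 x)) (B.1 x) := by
      rw [hG, hG, warpForm_comm]
    rw [h3] at h1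
    rw [warpForm_comm ε ν a (Φ x) (mvfderiv I Φ x (B.1 x))] at h1
    simp only [T]
    linarith
  have ext (v : TangentSpace I x) : ∃ A : S, A.1 x = v :=
    ⟨⟨FiberBundle.extend E v, FiberBundle.mdifferentiableAt_extend I E v⟩, by simp⟩
  obtain ⟨A, rfl⟩ := ext u
  obtain ⟨C, rfl⟩ := ext w
  have h0 : T A ⟨V, hV⟩ C = 0 := by
    have e1 := T1 A ⟨V, hV⟩ C
    have e2 := T2 ⟨V, hV⟩ A C
    have e3 := T1 ⟨V, hV⟩ C A
    have e4 := T2 C ⟨V, hV⟩ A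
    have e5 := T1 C A ⟨V, hV⟩
    have e6 := T2 A C ⟨V, hV⟩
    linarith
  exact sub_eq_zero.1 h0

end LeviCivita

section Curvature

variable {E : Type*} [NormedAddCommGroup E] [NormedSpace ℝ E] [CompleteSpace E]
  {H : Type*} [TopologicalSpace H] {I : ModelWithCorners ℝ E H} [I.Boundaryless]
  {M : Type*} [TopologicalSpace M] [ChartedSpace H M] [IsManifold I ∞ M]
  {N : ℕ} {ε c : ℝ} {ν : ℕ} {a : ℝ → ℝ} {Φ W : M → ℝ × Ambient N}

/-- The derivative of `W` along `Φ` in the direction of a vector field is differentiable. -/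
theorem mdifferentiableAt_warpDeriv {x : M} {X : ∀ y : M, TangentSpace I y}
    (ha : DifferentiableAt ℝ a (Φ x).1) (ha' : DifferentiableAt ℝ (deriv a) (Φ x).1)
    (ha0 : a (Φ x).1 ≠ 0)
    (hΦ : ContMDiffAt I 𝓘(ℝ, ℝ × Ambient N) 2 Φ x) (hW : ContMDiffAt I 𝓘(ℝ, ℝ × Ambient N) 2 W x)
    (hX : MDifferentiableAt I I.tangent (fun y => (⟨y, X y⟩ : TangentBundle I M)) x) :
    MDifferentiableAt I 𝓘(ℝ, ℝ × Ambient N) (fun y => warpDeriv I ε c ν a Φ W y (X y)) x :=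
  (((mdifferentiableAt_mvfderiv_apply_and_bracket hW hX hX).1.hasVDeriv 0).add
    (hasVDeriv_christoffel ha ha' (ha'.hasDerivAt.div ha.hasDerivAt ha0)
      ((hΦ.mdifferentiableAt (by simp)).hasVDeriv 0)
      ((mdifferentiableAt_mvfderiv_apply_and_bracket hΦ hX hX).1.hasVDeriv 0)
      ((hW.mdifferentiableAt (by simp)).hasVDeriv 0))).1

/-- The curvature of the warped product, paired with a normal vector. -/
theorem warpForm_curvature {x : M} {X Y : ∀ y : M, TangentSpace I y} (hε : ε * ε = 1)
    (ha : DifferentiableAt ℝ a (Φ x).1) (ha' : DifferentiableAt ℝ (deriv a) (Φ x).1)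
    (ha0 : a (Φ x).1 ≠ 0)
    (hΦ : ContMDiffAt I 𝓘(ℝ, ℝ × Ambient N) 2 Φ x) (hW : ContMDiffAt I 𝓘(ℝ, ℝ × Ambient N) 2 W x)
    (hX : MDifferentiableAt I I.tangent (fun y => (⟨y, X y⟩ : TangentBundle I M)) x)
    (hY : MDifferentiableAt I I.tangent (fun y => (⟨y, Y y⟩ : TangentBundle I M)) x)
    (hc : ∀ y, flatMetric N ν (Φ y).2 (Φ y).2 = c)
    {η : ℝ × Ambient N} (hpη : flatMetric N ν (Φ x).2 η.2 = 0)
    (hXη : warpForm ε ν a (Φ x) (mvfderiv I Φ x (X x)) η = 0)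
    (hYη : warpForm ε ν a (Φ x) (mvfderiv I Φ x (Y x)) η = 0) :
    warpForm ε ν a (Φ x)
        (warpDeriv I ε c ν a Φ (fun y => warpDeriv I ε c ν a Φ W y (X y)) x (Y x)) η -
      warpForm ε ν a (Φ x)
        (warpDeriv I ε c ν a Φ (fun y => warpDeriv I ε c ν a Φ W y (Y y)) x (X x)) η -
      warpForm ε ν a (Φ x) (warpDeriv I ε c ν a Φ W x (mlieBracket I Y X x)) η =
    (deriv (deriv a) (Φ x).1 / a (Φ x).1 - deriv a (Φ x).1 ^ 2 / a (Φ x).1 ^ 2 +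
        ε * c / a (Φ x).1 ^ 2) * η.1 *
      ((mvfderiv I Φ x (X x)).1 * warpForm ε ν a (Φ x) (mvfderiv I Φ x (Y x)) (W x) -
        (mvfderiv I Φ x (Y x)).1 * warpForm ε ν a (Φ x) (mvfderiv I Φ x (X x)) (W x)) := by
  have hder : ∀ {X Y : ∀ y : M, TangentSpace I y},
      MDifferentiableAt I I.tangent (fun y => (⟨y, X y⟩ : TangentBundle I M)) x →
      mvfderiv I (fun y => warpDeriv I ε c ν a Φ W y (X y)) x (Y x) = _ := fun {X Y} hX =>
    (((mdifferentiableAt_mvfderiv_apply_and_bracket hW hX hX).1.hasVDeriv (Y x)).add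
    (hasVDeriv_christoffel ha ha' (ha'.hasDerivAt.div ha.hasDerivAt ha0)
      ((hΦ.mdifferentiableAt (by simp)).hasVDeriv (Y x))
      ((mdifferentiableAt_mvfderiv_apply_and_bracket hΦ hX hX).1.hasVDeriv (Y x))
      ((hW.mdifferentiableAt (by simp)).hasVDeriv (Y x)))).2
  have e1 := hder (Y := Y) hX
  have e2 := hder (Y := X) hY
  have e3 := mvfderiv_mvfderiv_apply_sub hW hY hX
  have e4 := mvfderiv_mvfderiv_apply_sub hΦ hY hX
  have hpX := flatMetric_mvfderiv_eq_zero (u := X x) (hΦ.mdifferentiableAt (by simp)) hc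
  have hpY := flatMetric_mvfderiv_eq_zero (u := Y x) (hΦ.mdifferentiableAt (by simp)) hc
  rw [flatMetric_symm] at hpX hpY
  rw [sub_eq_iff_eq_add] at e3 e4
  simp only [warpDeriv] at e1 e2 ⊢
  rw [e1, e2, e3, e4]
  obtain ⟨b, hb⟩ : ∃ b, deriv a (Φ x).1 / a (Φ x).1 = b := ⟨_, rfl⟩
  obtain ⟨b', hb'⟩ : ∃ b', (deriv (deriv a) (Φ x).1 * a (Φ x).1 -
    deriv a (Φ x).1 * deriv a (Φ x).1) / a (Φ x).1 ^ 2 = b' := ⟨_, rfl⟩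
  have h1 : deriv a (Φ x).1 = b * a (Φ x).1 := by rw [← hb]; field_simp
  have h2 : deriv (deriv a) (Φ x).1 = (b' + b ^ 2) * a (Φ x).1 := by
    rw [← hb', ← hb]; field_simp; ring
  have h3 : flatMetric N ν (mvfderiv I Φ x (Y x)).2 (mvfderiv I Φ x (X x)).2 =
    flatMetric N ν (mvfderiv I Φ x (X x)).2 (mvfderiv I Φ x (Y x)).2 := flatMetric_symm ..
  have h4 : ε * c / a (Φ x).1 ^ 2 * a (Φ x).1 ^ 2 = ε * c := by field_simp
  have h5 : deriv (deriv a) (Φ x).1 / a (Φ x).1 = b' + b ^ 2 := by rw [h2]; field_simp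
  have h6 : deriv a (Φ x).1 ^ 2 / a (Φ x).1 ^ 2 = b ^ 2 := by rw [h1]; field_simp
  rw [h5, h6]
  simp only [warpForm] at hXη hYη
  simp only [warpForm, christoffel, Prod.fst_add, Prod.snd_add, map_add, map_smul,
    add_apply, smul_apply, smul_eq_mul, hb, hb', hpη, hpX, hpY, h3]
  rw [h1, h2]
  obtain ⟨r, hr⟩ : ∃ r, ε * c / a (Φ x).1 ^ 2 = r := ⟨_, rfl⟩
  rw [hr] at h4 ⊢
  linear_combination
    ((b' + b ^ 2) * (W x).1 * (mvfderiv I Φ x (Y x)).1 -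
      (c - ε * (b * a (Φ x).1) ^ 2) * flatMetric N ν (mvfderiv I Φ x (Y x)).2 (W x).2) * hXη +
    (-(b' + b ^ 2) * (W x).1 * (mvfderiv I Φ x (X x)).1 +
      (c - ε * (b * a (Φ x).1) ^ 2) * flatMetric N ν (mvfderiv I Φ x (X x)).2 (W x).2) * hYη +
    η.1 * ((mvfderiv I Φ x (X x)).1 * flatMetric N ν (mvfderiv I Φ x (Y x)).2 (W x).2 -
      (mvfderiv I Φ x (Y x)).1 * flatMetric N ν (mvfderiv I Φ x (X x)).2 (W x).2) *
      (a (Φ x).1 ^ 2 * b' * hε - h4)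

end Curvature

section Opens

variable {E : Type*} [NormedAddCommGroup E] [NormedSpace ℝ E]
  {H : Type*} [TopologicalSpace H] {I : ModelWithCorners ℝ E H} [I.Boundaryless]
  {M : Type*} [TopologicalSpace M] [ChartedSpace H M]
  {F : Type*} [NormedAddCommGroup F] [NormedSpace ℝ F]

theorem mvfderiv_comp_subtype_val {U : TopologicalSpace.Opens M} {h : M → F} {x : U}
    (hh : MDifferentiableAt I 𝓘(ℝ, F) h x) (u : E) :
    mvfderiv I (fun y : U => h y) x u = mvfderiv I h (x : M) u := by
  have hr : range I = univ := I.range_eq_univ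
  have hv : MDifferentiableAt I I (Subtype.val : U → M) x :=
    (contMDiff_subtype_val (n := ∞) x).mdifferentiableAt (by simp)
  have hc : MDifferentiableAt I 𝓘(ℝ, F) (fun y : U => h y) x := hh.comp x hv
  rw [MDifferentiableAt.mvfderiv hc, MDifferentiableAt.mvfderiv hh, hr, fderivWithin_univ,
    fderivWithin_univ]
  have e0 : extChartAt I x x = extChartAt I (x : M) x := rfl
  have e : writtenInExtChartAt I 𝓘(ℝ, F) x (fun y : U => h y) =ᶠ[𝓝 (extChartAt I (x : M) x)]
      writtenInExtChartAt I 𝓘(ℝ, F) (x : M) h := by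
    have h1 := U.chartAt_subtype_val_symm_eventuallyEq (H := H) (x := x)
    have h2 : ContinuousAt I.symm (extChartAt I (x : M) x) := I.continuous_symm.continuousAt
    have h3 : (chartAt H (x : M)).symm =ᶠ[𝓝 (I.symm (extChartAt I (x : M) x))]
        Subtype.val ∘ (chartAt H x).symm := by simpa [extChartAt] using h1
    filter_upwards [h2.tendsto.eventually h3] with z hz
    simp only [writtenInExtChartAt, extChartAt_coe_symm, Function.comp_apply] at hz ⊢
    rw [hz]
  rw [e0, e.fderiv_eq]
  rfl

end Opens

section Hyperquadric

variable {N ν : ℕ} {c : ℤˣ}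

theorem Quadric.hasFDerivAt_lift (p : Quadric N ν c) : HasFDerivAt p.lift p.ofPerp 0 := by
  have h0 : HasFDerivAt (fun y => p.ofPerp y) p.ofPerp 0 := p.ofPerp.hasFDerivAt
  have h1 := (flatMetric N ν).isBoundedBilinearMap.hasFDerivAt (p.ofPerp 0, p.ofPerp 0)
  have h2 : HasFDerivAt (fun y => flatMetric N ν (p.ofPerp y) (p.ofPerp y))
      (0 : EuclideanSpace ℝ (Fin N) →L[ℝ] ℝ) 0 := by
    refine (HasFDerivAt.comp (g := fun q : Ambient N × Ambient N => flatMetric N ν q.1 q.2)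
      (f := fun y => (p.ofPerp y, p.ofPerp y)) 0 h1 (h0.prodMk h0)).congr_fderiv ?_
    ext v
    simp
  have h3 : HasFDerivAt p.height (0 : EuclideanSpace ℝ (Fin N) →L[ℝ] ℝ) 0 := by
    exact ((h2.const_mul ((c : ℤ) : ℝ)).const_sub 1).congr_fderiv (by simp)
  have h4 : p.height 0 = 1 := by simp [Quadric.height]
  have h5 := h3.sqrt (by rw [h4]; norm_num)
  have h6 := h0.add (h5.smul_const (p : Ambient N))
  refine h6.congr_fderiv ?_
  ext v
  simp

theorem Quadric.contDiffAt_lift (p : Quadric N ν c) {y : EuclideanSpace ℝ (Fin N)}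
    (hy : 0 < p.height y) : ContDiffAt ℝ ∞ p.lift y :=
  p.ofPerp.contDiff.contDiffAt.add
    (ContDiffAt.smul (ContDiffAt.sqrt p.contDiff_height.contDiffAt hy.ne') contDiffAt_const)

theorem Quadric.writtenInExtChartAt_val (p : Quadric N ν c) :
    writtenInExtChartAt (𝓡 N) 𝓘(ℝ, Ambient N) p Quadric.val =ᶠ[𝓝 0] p.lift := by
  have h4 : p.height 0 = 1 := by simp [Quadric.height]
  have h5 : ∀ᶠ y in 𝓝 (0 : EuclideanSpace ℝ (Fin N)), 0 < p.height y :=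
    (p.contDiff_height (k := 0)).continuous.continuousAt.eventually (lt_mem_nhds (by simp [h4]))
  filter_upwards [h5] with y hy
  change ((p.chart.symm y : Quadric N ν c) : Ambient N) = p.lift y
  simp [Quadric.chart, dif_pos hy]

theorem Quadric.extChartAt_self (p : Quadric N ν c) : extChartAt (𝓡 N) p p = 0 :=
  p.toPerp_self

theorem Quadric.contMDiff_val :
    ContMDiff (𝓡 N) 𝓘(ℝ, Ambient N) ∞ (Quadric.val : Quadric N ν c → Ambient N) := by
  intro p
  rw [contMDiffAt_iff]
  refine ⟨Quadric.continuous_val.continuousAt, ?_⟩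
  have h4 : p.height 0 = 1 := by simp [Quadric.height]
  rw [p.extChartAt_self]
  exact ((p.contDiffAt_lift (by simp [h4])).congr_of_eventuallyEq
    p.writtenInExtChartAt_val).contDiffWithinAt

theorem Quadric.mvfderiv_val (p : Quadric N ν c) (u : EuclideanSpace ℝ (Fin N)) :
    mvfderiv (𝓡 N) (Quadric.val : Quadric N ν c → Ambient N) p u = p.ofPerp u := by
  have h1 : MDifferentiableAt (𝓡 N) 𝓘(ℝ, Ambient N) (Quadric.val : Quadric N ν c → Ambient N) p :=
    (Quadric.contMDiff_val p).mdifferentiableAt (by simp)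
  rw [MDifferentiableAt.mvfderiv h1, p.extChartAt_self, (𝓡 N).range_eq_univ, fderivWithin_univ,
    p.writtenInExtChartAt_val.fderiv_eq, p.hasFDerivAt_lift.fderiv]
  rfl

theorem flatMetric_nondegenerate {x : Ambient N} (hx : ∀ y, flatMetric N ν x y = 0) : x = 0 := by
  ext i
  have h := hx (EuclideanSpace.single i 1)
  rw [flatMetric_apply, Finset.sum_eq_single i (by intro j _ hj; simp [hj]) (by simp)] at h
  split_ifs at h <;> simpa using h

end Hyperquadric

section WarpedProduct

variable {N ν : ℕ} {c : ℤˣ} (J : TopologicalSpace.Opens ℝ) (o : Quadric N ν c)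

/-- The inclusion of the warped product in `ℝ × ℝ^{N+1}`. -/
def warpIncl (q : J × spaceForm o) : ℝ × Ambient N :=
  ((q.1 : ℝ), ((q.2 : Quadric N ν c) : Ambient N))

variable {J o}

theorem contMDiff_spaceForm_val :
    ContMDiff (𝓡 N) 𝓘(ℝ, Ambient N) ∞
      (fun q : spaceForm o => ((q : Quadric N ν c) : Ambient N)) :=
  Quadric.contMDiff_val.comp contMDiff_subtype_val

theorem contMDiff_warpIncl :
    ContMDiff (𝓘(ℝ, ℝ).prod (𝓡 N)) 𝓘(ℝ, ℝ × Ambient N) ∞ (warpIncl J o) :=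
  ContMDiff.prodMk_space (contMDiff_subtype_val.comp contMDiff_fst)
    (contMDiff_spaceForm_val.comp contMDiff_snd)

theorem mdifferentiableAt_warpIncl (q : J × spaceForm o) :
    MDifferentiableAt (𝓘(ℝ, ℝ).prod (𝓡 N)) 𝓘(ℝ, ℝ × Ambient N) (warpIncl J o) q :=
  (contMDiff_warpIncl q).mdifferentiableAt (by simp)

theorem flatMetric_warpIncl (q : J × spaceForm o) :
    flatMetric N ν (warpIncl J o q).2 (warpIncl J o q).2 = ((c : ℤ) : ℝ) :=
  (q.2 : Quadric N ν c).self_eq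

theorem mvfderiv_warpIncl_fst (q : J × spaceForm o)
    (v : TangentSpace (𝓘(ℝ, ℝ).prod (𝓡 N)) q) :
    (mvfderiv (𝓘(ℝ, ℝ).prod (𝓡 N)) (warpIncl J o) q v).1 =
      mvfderiv (𝓘(ℝ, ℝ).prod (𝓡 N)) (fun r : J × spaceForm o => (r.1 : ℝ)) q v :=
  ((mdifferentiableAt_warpIncl q).hasVDeriv v).fst.2.symm

theorem mvfderiv_warpIncl_snd (q : J × spaceForm o)
    (v : TangentSpace (𝓘(ℝ, ℝ).prod (𝓡 N)) q) :
    (mvfderiv (𝓘(ℝ, ℝ).prod (𝓡 N)) (warpIncl J o) q v).2 =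
      mvfderiv (𝓡 N) (fun q : spaceForm o => ((q : Quadric N ν c) : Ambient N)) q.2
        (mfderiv (𝓘(ℝ, ℝ).prod (𝓡 N)) (𝓡 N) (Prod.snd : J × spaceForm o → spaceForm o) q v) := by
  refine ((mdifferentiableAt_warpIncl q).hasVDeriv v).snd.2.symm.trans ?_
  exact mfderiv_comp_apply (I'' := 𝓘(ℝ, Ambient N)) q
    ((contMDiff_spaceForm_val q.2).mdifferentiableAt (by simp)) mdifferentiableAt_snd v

theorem ambientMetric_eq_warpForm (ε : ℤˣ) (a : ℝ → ℝ) (q : J × spaceForm o)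
    (v w : TangentSpace (𝓘(ℝ, ℝ).prod (𝓡 N)) q) :
    ambientMetric ε J a o q v w = warpForm ((ε : ℤ) : ℝ) ν a (warpIncl J o q)
      (mvfderiv (𝓘(ℝ, ℝ).prod (𝓡 N)) (warpIncl J o) q v)
      (mvfderiv (𝓘(ℝ, ℝ).prod (𝓡 N)) (warpIncl J o) q w) := by
  simp only [warpForm, mvfderiv_warpIncl_fst, mvfderiv_warpIncl_snd]
  rfl

theorem mvfderiv_warpIncl_apply (q : J × spaceForm o) (v : ℝ × EuclideanSpace ℝ (Fin N)) :
    mvfderiv (𝓘(ℝ, ℝ).prod (𝓡 N)) (warpIncl J o) q v =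
      (v.1, (q.2 : Quadric N ν c).ofPerp v.2) := by
  ext1
  · refine (mvfderiv_warpIncl_fst q v).trans ?_
    have h1 := mfderiv_comp_apply (I := 𝓘(ℝ, ℝ).prod (𝓡 N)) (I' := 𝓘(ℝ, ℝ)) (I'' := 𝓘(ℝ, ℝ))
      (g := (Subtype.val : J → ℝ)) (f := (Prod.fst : J × spaceForm o → J)) q
      ((contMDiff_subtype_val (n := ∞) q.1).mdifferentiableAt (by simp)) mdifferentiableAt_fst v
    refine h1.trans ?_
    rw [mfderiv_fst]
    refine (mvfderiv_comp_subtype_val (I := 𝓘(ℝ, ℝ)) (h := (id : ℝ → ℝ)) (x := q.1)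
      mdifferentiableAt_id v.1).trans ?_
    simp [mvfderiv, mfderiv_id]
    rfl
  · refine (mvfderiv_warpIncl_snd q v).trans ?_
    rw [mfderiv_snd]
    refine (mvfderiv_comp_subtype_val (I := 𝓡 N) (h := (Quadric.val : Quadric N ν c → Ambient N))
      (x := q.2) ((Quadric.contMDiff_val _).mdifferentiableAt (by simp)) v.2).trans ?_
    exact Quadric.mvfderiv_val _ _

theorem exists_mvfderiv_warpIncl_eq (q : J × spaceForm o) {z : ℝ × Ambient N}
    (hz : flatMetric N ν (warpIncl J o q).2 z.2 = 0) :
    ∃ v, mvfderiv (𝓘(ℝ, ℝ).prod (𝓡 N)) (warpIncl J o) q v = z := by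
  refine ⟨((z.1, (q.2 : Quadric N ν c).toPerp z.2) : ℝ × EuclideanSpace ℝ (Fin N)), ?_⟩
  have hz' : flatMetric N ν ((q.2 : Quadric N ν c) : Ambient N) z.2 = 0 := hz
  refine (mvfderiv_warpIncl_apply q _).trans ?_
  rw [Quadric.ofPerp_toPerp, hz', mul_zero, zero_smul, sub_zero]

theorem mvfderiv_warpIncl_partialT (q : J × spaceForm o) :
    mvfderiv (𝓘(ℝ, ℝ).prod (𝓡 N)) (warpIncl J o) q (partialT (𝓡 N) J q) = (1, 0) := by
  refine (mvfderiv_warpIncl_apply q _).trans ?_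
  simp [partialT]

/-- The form of the warped product is nondegenerate on the tangent spaces. -/
theorem eq_zero_of_warpForm_eq_zero {ε : ℝ} (hε : ε ≠ 0) {a : ℝ → ℝ} (q : J × spaceForm o)
    (ha0 : a q.1 ≠ 0) {d : ℝ × Ambient N} (hd : flatMetric N ν (warpIncl J o q).2 d.2 = 0)
    (h : ∀ w, warpForm ε ν a (warpIncl J o q) d
      (mvfderiv (𝓘(ℝ, ℝ).prod (𝓡 N)) (warpIncl J o) q w) = 0) : d = 0 := by
  have h' : ∀ z : ℝ × Ambient N, flatMetric N ν (warpIncl J o q).2 z.2 = 0 →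
      warpForm ε ν a (warpIncl J o q) d z = 0 := by
    intro z hz
    obtain ⟨v, rfl⟩ := exists_mvfderiv_warpIncl_eq q hz
    exact h v
  ext1
  · have h1 := h' (1, 0) (by simp)
    simpa [warpForm, hε] using h1
  · refine flatMetric_nondegenerate (ν := ν) fun y => ?_
    have hc := flatMetric_warpIncl q
    have hcc := sign_mul_self c
    have h1 := h' (0, y - (((c : ℤ) : ℝ) * flatMetric N ν (warpIncl J o q).2 y) •
      (warpIncl J o q).2) (by
        simp only [map_sub, map_smul, smul_eq_mul, hc]
        linear_combination -(flatMetric N ν (warpIncl J o q).2 y) * hcc)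
    have ha0' : a (warpIncl J o q).1 ≠ 0 := ha0
    rw [flatMetric_symm] at hd
    simpa [warpForm, map_sub, hd, ha0'] using h1

/-- The Levi-Civita connection of the warped product. -/
theorem mvfderiv_warpIncl_leviCivita {ε : ℤˣ} {a : ℝ → ℝ}
    {D : CovariantDerivative (𝓘(ℝ, ℝ).prod (𝓡 N)) (ℝ × EuclideanSpace ℝ (Fin N))
      (TangentSpace (𝓘(ℝ, ℝ).prod (𝓡 N)) : J × spaceForm o → Type _)}
    (hD : IsLeviCivita (ambientMetric ε J a o) D) {q : J × spaceForm o}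
    (ha : DifferentiableAt ℝ a q.1) (ha0 : a q.1 ≠ 0)
    {S : ∀ r : J × spaceForm o, TangentSpace (𝓘(ℝ, ℝ).prod (𝓡 N)) r}
    (hS : MDifferentiableAt (𝓘(ℝ, ℝ).prod (𝓡 N)) (𝓘(ℝ, ℝ).prod (𝓡 N)).tangent
      (fun r => (⟨r, S r⟩ : TangentBundle (𝓘(ℝ, ℝ).prod (𝓡 N)) (J × spaceForm o))) q)
    (u : TangentSpace (𝓘(ℝ, ℝ).prod (𝓡 N)) q) :
    mvfderiv (𝓘(ℝ, ℝ).prod (𝓡 N)) (warpIncl J o) q (D S q u) =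
      warpDeriv (𝓘(ℝ, ℝ).prod (𝓡 N)) ((ε : ℤ) : ℝ) ((c : ℤ) : ℝ) ν a (warpIncl J o)
        (fun r => mvfderiv (𝓘(ℝ, ℝ).prod (𝓡 N)) (warpIncl J o) r (S r)) q u := by
  have hε := sign_mul_self ε
  have hε0 : ((ε : ℤ) : ℝ) ≠ 0 := left_ne_zero_of_mul_eq_one hε
  have hdS : MDifferentiableAt (𝓘(ℝ, ℝ).prod (𝓡 N)) 𝓘(ℝ, ℝ × Ambient N)
      (fun r => mvfderiv (𝓘(ℝ, ℝ).prod (𝓡 N)) (warpIncl J o) r (S r)) q :=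
    (mdifferentiableAt_mvfderiv_apply_and_bracket
      ((contMDiff_warpIncl q).of_le ENat.LEInfty.out) hS hS).1
  have hperp (r : J × spaceForm o) (v : TangentSpace (𝓘(ℝ, ℝ).prod (𝓡 N)) r) :
      flatMetric N ν (warpIncl J o r).2
        (mvfderiv (𝓘(ℝ, ℝ).prod (𝓡 N)) (warpIncl J o) r v).2 = 0 :=
    flatMetric_mvfderiv_eq_zero (mdifferentiableAt_warpIncl r) flatMetric_warpIncl
  rw [← sub_eq_zero]
  refine eq_zero_of_warpForm_eq_zero hε0 q ha0 ?_ fun w => ?_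
  · rw [Prod.snd_sub, map_sub, hperp, flatMetric_warpDeriv_eq_zero (sign_mul_self c)
      (mdifferentiableAt_warpIncl q) hdS flatMetric_warpIncl
      (Filter.Eventually.of_forall fun r => hperp r _), sub_zero]
  · rw [warpForm_sub_left, warpForm_warpDeriv_eq hε contMDiff_warpIncl flatMetric_warpIncl
      (ambientMetric_eq_warpForm ε a) hD ha ha0 hS, ambientMetric_eq_warpForm, sub_self]

end WarpedProduct

section Along

variable {E : Type*} [NormedAddCommGroup E] [NormedSpace ℝ E]
  {H : Type*} [TopologicalSpace H] {I : ModelWithCorners ℝ E H}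
  {M : Type*} [TopologicalSpace M] [ChartedSpace H M]
  {F : Type*} [NormedAddCommGroup F] [NormedSpace ℝ F] [FiniteDimensional ℝ F]
  {G : Type*} [TopologicalSpace G] {J : ModelWithCorners ℝ F G} [J.Boundaryless]
  {P : Type*} [TopologicalSpace P] [ChartedSpace G P] [IsManifold J ∞ P]
  {V : Type*} [NormedAddCommGroup V] [NormedSpace ℝ V]

theorem mvfderiv_apply_along {ι : P → V} (hι : ContMDiff J 𝓘(ℝ, V) ∞ ι) {f : M → P} {x : M}
    (hf : MDifferentiableAt I J f x) {W : ∀ y : M, TangentSpace J (f y)}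
    (hW : MDifferentiableAt I J.tangent (fun y => (⟨f y, W y⟩ : TangentBundle J P)) x)
    (u : TangentSpace I x) :
    mvfderiv I (fun y => mvfderiv J ι (f y) (W y)) x u =
      mvfderiv J ι (f x) ((trivializationAt F (TangentSpace J : P → Type _) (f x)).symm (f x)
        (mvfderiv I (fun y => (trivializationAt F (TangentSpace J : P → Type _) (f x)
          (⟨f y, W y⟩ : TangentBundle J P)).2) x u)) +
      mvfderiv J (fun q => mvfderiv J ι q (FiberBundle.extend F (W x) q)) (f x)
        (mfderiv I J f x u) := by
  have : CompleteSpace F := FiniteDimensional.complete ℝ F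
  have : IsManifold J 1 P := .of_le (n := ∞) (by simp)
  set t := trivializationAt F (TangentSpace J : P → Type _) (f x) with ht
  set w : M → F := fun y => (t (⟨f y, W y⟩ : TangentBundle J P)).2 with hw
  have hwd : MDifferentiableAt I 𝓘(ℝ, F) w x := by
    exact ((mdifferentiableAt_totalSpace J _).1 hW).2
  let b := Module.finBasis ℝ F
  let e : Fin (Module.finrank ℝ F) → ∀ q : P, TangentSpace J q := fun i q => t.symm q (b i)
  have hxb : f x ∈ t.baseSet := FiberBundle.mem_baseSet_trivializationAt' (f x)
  have he (i) : MDifferentiableAt J J.tangent (fun q => (⟨q, e i q⟩ : TangentBundle J P)) (f x) := by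
    have h1 := FiberBundle.mdifferentiableAt_extend J F
      (t.symm (f x) (b i) : TangentSpace J (f x))
    have h2 : FiberBundle.extend F (t.symm (f x) (b i) : TangentSpace J (f x)) = e i := by
      funext q
      simp only [FiberBundle.extend, e]
      rw [← ht, t.apply_mk_symm hxb]
    rwa [h2] at h1
  have hde (i) : MDifferentiableAt J 𝓘(ℝ, V) (fun q => mvfderiv J ι q (e i q)) (f x) :=
    (mdifferentiableAt_mvfderiv_apply_and_bracket
      ((hι (f x)).of_le ENat.LEInfty.out) (he i) (he i)).1
  have hsum {q : P} (hq : q ∈ t.baseSet) (v : F) : (t.symm q v : TangentSpace J q) = ∑ i, b.repr v i • e i q := by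
    conv_lhs => rw [← b.sum_repr v]
    have h1 : ∀ v : F, (t.symm q v : TangentSpace J q) = t.symmₗ ℝ q v := fun v => by
      rw [Bundle.Trivialization.coe_symmₗ t hq]
    rw [h1, map_sum]
    refine Finset.sum_congr rfl fun i _ => ?_
    rw [map_smul, ← h1]
  have hwi (i) : HasVDeriv I (fun y => b.repr (w y) i) x u (b.repr (mvfderiv I w x u) i) :=
    HasVDeriv.comp_hasFDerivAt (φ := fun v : F => b.repr v i)
      (LinearMap.toContinuousLinearMap (b.coord i)).hasFDerivAt (hwd.hasVDeriv u)
  have hcomp (i) : HasVDeriv I (fun y => mvfderiv J ι (f y) (e i (f y))) x u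
      (mvfderiv J (fun q => mvfderiv J ι q (e i q)) (f x) (mfderiv I J f x u)) :=
    ⟨(hde i).comp x hf, mfderiv_comp_apply x (hde i) hf u⟩
  have k1 := HasVDeriv.sum Finset.univ fun i _ => (hwi i).smul (hcomp i)
  have k2 := k1.congr_of_eventuallyEq (k := fun y => mvfderiv J ι (f y) (W y)) (by
    have h1 : ∀ᶠ y in 𝓝 x, f y ∈ t.baseSet :=
      hf.continuousAt.eventually (t.open_baseSet.mem_nhds hxb)
    filter_upwards [h1] with y hy
    have h2 : W y = t.symm (f y) (w y) := (t.symm_apply_apply_mk hy (W y)).symm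
    rw [h2, hsum hy, map_sum]
    simp only [map_smul])
  have k3 : HasVDeriv J (fun q => mvfderiv J ι q (FiberBundle.extend F (W x) q)) (f x)
      (mfderiv I J f x u) (∑ i, (b.repr (w x) i) •
        mvfderiv J (fun q => mvfderiv J ι q (e i q)) (f x) (mfderiv I J f x u)) := by
    have h1 := HasVDeriv.sum Finset.univ fun i _ =>
      (hasVDeriv_const (b.repr (w x) i) (f x) (mfderiv I J f x u)).smul
        ((hde i).hasVDeriv (mfderiv I J f x u))
    simp only [zero_smul, add_zero] at h1
    refine h1.congr_of_eventuallyEq ?_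
    filter_upwards [t.open_baseSet.mem_nhds hxb] with q hq
    have h2 : FiberBundle.extend F (W x) q = t.symm q (w x) := rfl
    rw [h2, hsum hq, map_sum]
    simp only [map_smul]
  rw [k2.2, k3.2, hsum hxb, map_sum, Finset.sum_add_distrib, add_comm]
  simp only [map_smul]

end Along

section DerivAlong

variable {E : Type*} [NormedAddCommGroup E] [NormedSpace ℝ E]
  {H : Type*} [TopologicalSpace H] {I : ModelWithCorners ℝ E H}
  {M : Type*} [TopologicalSpace M] [ChartedSpace H M]
  {N ν : ℕ} {c : ℤˣ} {J : TopologicalSpace.Opens ℝ} {o : Quadric N ν c}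

/-- The induced covariant derivative of fields along a map to the warped product. -/
theorem mvfderiv_warpIncl_derivAlong {ε : ℤˣ} {a : ℝ → ℝ}
    {D : CovariantDerivative (𝓘(ℝ, ℝ).prod (𝓡 N)) (ℝ × EuclideanSpace ℝ (Fin N))
      (TangentSpace (𝓘(ℝ, ℝ).prod (𝓡 N)) : J × spaceForm o → Type _)}
    (hD : IsLeviCivita (ambientMetric ε J a o) D) {f : M → J × spaceForm o} {x : M}
    (ha : DifferentiableAt ℝ a (f x).1) (ha0 : a (f x).1 ≠ 0)
    (hf : MDifferentiableAt I (𝓘(ℝ, ℝ).prod (𝓡 N)) f x)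
    {W : ∀ y : M, TangentSpace (𝓘(ℝ, ℝ).prod (𝓡 N)) (f y)}
    (hW : MDifferentiableAt I (𝓘(ℝ, ℝ).prod (𝓡 N)).tangent
      (fun y => (⟨f y, W y⟩ : TangentBundle (𝓘(ℝ, ℝ).prod (𝓡 N)) (J × spaceForm o))) x)
    (u : TangentSpace I x) :
    mvfderiv (𝓘(ℝ, ℝ).prod (𝓡 N)) (warpIncl J o) (f x) (derivAlong D f W x u) =
      warpDeriv I ((ε : ℤ) : ℝ) ((c : ℤ) : ℝ) ν a (fun y => warpIncl J o (f y))
        (fun y => mvfderiv (𝓘(ℝ, ℝ).prod (𝓡 N)) (warpIncl J o) (f y) (W y)) x u := by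
  have h1 := mvfderiv_apply_along contMDiff_warpIncl hf hW u
  have h2 := mvfderiv_warpIncl_leviCivita hD ha ha0
    (FiberBundle.mdifferentiableAt_extend (𝓘(ℝ, ℝ).prod (𝓡 N)) (ℝ × EuclideanSpace ℝ (Fin N))
      (W x)) (mfderiv I (𝓘(ℝ, ℝ).prod (𝓡 N)) f x u)
  have h3 : mvfderiv I (fun y => warpIncl J o (f y)) x u =
      mvfderiv (𝓘(ℝ, ℝ).prod (𝓡 N)) (warpIncl J o) (f x)
        (mfderiv I (𝓘(ℝ, ℝ).prod (𝓡 N)) f x u) :=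
    mfderiv_comp_apply x (mdifferentiableAt_warpIncl (f x)) hf u
  rw [derivAlong, map_add, h2, warpDeriv, warpDeriv, h1, h3, FiberBundle.extend_apply_self,
    add_assoc]

end DerivAlong

section Immersion

variable {E : Type*} [NormedAddCommGroup E] [NormedSpace ℝ E] [FiniteDimensional ℝ E]
  {H : Type*} [TopologicalSpace H] {I : ModelWithCorners ℝ E H}
  {M : Type*} [TopologicalSpace M] [ChartedSpace H M] [IsManifold I ∞ M]
  {F : Type*} [NormedAddCommGroup F] [NormedSpace ℝ F] [FiniteDimensional ℝ F]
  {G : Type*} [TopologicalSpace G] {J : ModelWithCorners ℝ F G}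
  {P : Type*} [TopologicalSpace P] [ChartedSpace G P] [IsManifold J ∞ P]
  {g : SemiRiemannianMetric I M} {gP : ∀ p : P, TangentSpace J p →L[ℝ] TangentSpace J p →L[ℝ] ℝ}
  {f : M → P}

omit [FiniteDimensional ℝ F] [IsManifold J ∞ P] in
theorem inner_tangentPart (x : M) (w : TangentSpace J (f x)) (v : TangentSpace I x) :
    g.inner x (tangentPart g gP f x w) v = gP (f x) w (mfderiv I J f x v) :=
  g.inner_sharp x _ v

omit [FiniteDimensional ℝ F] [IsManifold J ∞ P] in
theorem isNormal_normalPart (hf : IsIsometricImmersion g gP f) (x : M)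
    (w : TangentSpace J (f x)) : IsNormal (I := I) gP f x (normalPart g gP f x w) := by
  intro v
  rw [normalPart, map_sub, sub_apply, hf.2, inner_tangentPart, sub_self]

omit [FiniteDimensional ℝ E] [FiniteDimensional ℝ F] in
theorem mdifferentiableAt_mfderiv_apply (hf : ContMDiff I J ∞ f) {x : M}
    {V : ∀ y : M, TangentSpace I y}
    (hV : MDifferentiableAt I I.tangent (fun y => (⟨y, V y⟩ : TangentBundle I M)) x) :
    MDifferentiableAt I J.tangent
      (fun y => (⟨f y, mfderiv I J f y (V y)⟩ : TangentBundle J P)) x := by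
  have : IsManifold I 1 M := .of_le (n := ∞) (by simp)
  have : IsManifold J 1 P := .of_le (n := ∞) (by simp)
  have h1 : ContMDiff I.tangent J.tangent ∞ (tangentMap I J f) :=
    hf.contMDiff_tangentMap (m := ∞) (by simp)
  exact ((h1 _).mdifferentiableAt (by simp)).comp x hV

end Immersion

section WarpedImmersion

variable {E : Type*} [NormedAddCommGroup E] [NormedSpace ℝ E] [FiniteDimensional ℝ E]
  {H : Type*} [TopologicalSpace H] {I : ModelWithCorners ℝ E H} [I.Boundaryless]
  {M : Type*} [TopologicalSpace M] [ChartedSpace H M] [IsManifold I ∞ M]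
  {N ν : ℕ} {c ε : ℤˣ} {J : TopologicalSpace.Opens ℝ} {o : Quadric N ν c} {a : ℝ → ℝ}
  {g : SemiRiemannianMetric I M} {f : M → J × spaceForm o}
  {D : CovariantDerivative I E (TangentSpace I : M → Type _)}
  {Dbar : CovariantDerivative (𝓘(ℝ, ℝ).prod (𝓡 N)) (ℝ × EuclideanSpace ℝ (Fin N))
    (TangentSpace (𝓘(ℝ, ℝ).prod (𝓡 N)) : J × spaceForm o → Type _)}

/-- A map to the warped product, seen as a map to `ℝ × ℝ^{N+1}`. -/
def warpMap (f : M → J × spaceForm o) (y : M) : ℝ × Ambient N := warpIncl J o (f y)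

/-- A field along a map to the warped product, seen as a map to `ℝ × ℝ^{N+1}`. -/
def warpField (f : M → J × spaceForm o)
    (W : ∀ y : M, TangentSpace (𝓘(ℝ, ℝ).prod (𝓡 N)) (f y)) (y : M) : ℝ × Ambient N :=
  mvfderiv (𝓘(ℝ, ℝ).prod (𝓡 N)) (warpIncl J o) (f y) (W y)

omit [FiniteDimensional ℝ E] [I.Boundaryless] [IsManifold I ∞ M] in
theorem contMDiff_warpMap (hf : ContMDiff I (𝓘(ℝ, ℝ).prod (𝓡 N)) ∞ f) :
    ContMDiff I 𝓘(ℝ, ℝ × Ambient N) ∞ (warpMap f) :=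
  contMDiff_warpIncl.comp hf

omit [FiniteDimensional ℝ E] [I.Boundaryless] [IsManifold I ∞ M] in
theorem contMDiffAt_warpField {W : ∀ y : M, TangentSpace (𝓘(ℝ, ℝ).prod (𝓡 N)) (f y)} {x : M}
    (hW : ContMDiffAt I (𝓘(ℝ, ℝ).prod (𝓡 N)).tangent ∞
      (fun y => (⟨f y, W y⟩ : TangentBundle (𝓘(ℝ, ℝ).prod (𝓡 N)) (J × spaceForm o))) x) :
    ContMDiffAt I 𝓘(ℝ, ℝ × Ambient N) ∞ (warpField f W) x :=
  (contMDiff_mvfderiv_tangentBundle contMDiff_warpIncl _).comp x hW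

omit [FiniteDimensional ℝ E] [I.Boundaryless] [IsManifold I ∞ M] in
theorem mvfderiv_warpMap (hf : ContMDiff I (𝓘(ℝ, ℝ).prod (𝓡 N)) ∞ f) (x : M)
    (v : TangentSpace I x) :
    mvfderiv I (warpMap f) x v = mvfderiv (𝓘(ℝ, ℝ).prod (𝓡 N)) (warpIncl J o) (f x)
      (mfderiv I (𝓘(ℝ, ℝ).prod (𝓡 N)) f x v) :=
  mfderiv_comp_apply x (mdifferentiableAt_warpIncl (f x)) ((hf x).mdifferentiableAt (by simp)) v

omit [I.Boundaryless] [FiniteDimensional ℝ E] in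
theorem inner_eq_warpForm (hf : IsIsometricImmersion g (ambientMetric ε J a o) f) (x : M)
    (u v : TangentSpace I x) :
    g.inner x u v = warpForm ((ε : ℤ) : ℝ) ν a (warpMap f x) (mvfderiv I (warpMap f) x u)
      (mvfderiv I (warpMap f) x v) := by
  rw [← hf.2, ambientMetric_eq_warpForm, mvfderiv_warpMap hf.1, mvfderiv_warpMap hf.1]
  rfl

omit [FiniteDimensional ℝ E] [I.Boundaryless] [IsManifold I ∞ M] in
theorem isNormal_iff_warpForm (hf : ContMDiff I (𝓘(ℝ, ℝ).prod (𝓡 N)) ∞ f) (x : M)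
    (w : TangentSpace (𝓘(ℝ, ℝ).prod (𝓡 N)) (f x)) :
    IsNormal (I := I) (ambientMetric ε J a o) f x w ↔
      ∀ v, warpForm ((ε : ℤ) : ℝ) ν a (warpMap f x) (mvfderiv I (warpMap f) x v)
        (mvfderiv (𝓘(ℝ, ℝ).prod (𝓡 N)) (warpIncl J o) (f x) w) = 0 := by
  refine forall_congr' fun v => ?_
  rw [ambientMetric_eq_warpForm, mvfderiv_warpMap hf, warpForm_comm]
  rfl

omit [FiniteDimensional ℝ E] [I.Boundaryless] [TopologicalSpace M] [ChartedSpace H M]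
  [IsManifold I ∞ M] in
theorem flatMetric_warpField (W : ∀ y : M, TangentSpace (𝓘(ℝ, ℝ).prod (𝓡 N)) (f y)) (x : M) :
    flatMetric N ν (warpMap f x).2 (warpField f W x).2 = 0 :=
  flatMetric_mvfderiv_eq_zero (mdifferentiableAt_warpIncl (f x)) flatMetric_warpIncl

/-- The Gauss formula. -/
theorem mvfderiv_warpIncl_secondFundamentalForm
    (hf : IsIsometricImmersion g (ambientMetric ε J a o) f) (hD : IsLeviCivita g.inner D)
    (hDbar : IsLeviCivita (ambientMetric ε J a o) Dbar) {x : M}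
    (ha : DifferentiableAt ℝ a (f x).1) (ha0 : a (f x).1 ≠ 0) {Z : ∀ y : M, TangentSpace I y}
    (hZ : MDifferentiableAt I I.tangent (fun y => (⟨y, Z y⟩ : TangentBundle I M)) x)
    (u : TangentSpace I x) :
    mvfderiv (𝓘(ℝ, ℝ).prod (𝓡 N)) (warpIncl J o) (f x)
        (secondFundamentalForm g (ambientMetric ε J a o) Dbar f x u (Z x)) =
      warpDeriv I ((ε : ℤ) : ℝ) ((c : ℤ) : ℝ) ν a (warpMap f)
          (fun y => mvfderiv I (warpMap f) y (Z y)) x u -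
        mvfderiv I (warpMap f) x (D Z x u) := by
  have : CompleteSpace E := FiniteDimensional.complete ℝ E
  have : IsManifold I 1 M := .of_le (n := ∞) (by simp)
  have : IsManifold I 2 M := .of_le (n := ∞) ENat.LEInfty.out
  have hΦ := contMDiff_warpMap hf.1
  have hext (v : TangentSpace I x) := FiberBundle.mdifferentiableAt_extend I E v
  set V : ∀ y : M, TangentSpace I y := FiberBundle.extend E (Z x) with hVdef
  have hVx : V x = Z x := FiberBundle.extend_apply_self E (Z x)
  have hV : MDifferentiableAt I I.tangent (fun y => (⟨y, V y⟩ : TangentBundle I M)) x :=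
    hext (Z x)
  have hder : mvfderiv (𝓘(ℝ, ℝ).prod (𝓡 N)) (warpIncl J o) (f x)
      (derivAlong Dbar f (fun y => mfderiv I (𝓘(ℝ, ℝ).prod (𝓡 N)) f y (V y)) x u) =
      warpDeriv I ((ε : ℤ) : ℝ) ((c : ℤ) : ℝ) ν a (warpMap f)
        (fun y => mvfderiv I (warpMap f) y (V y)) x u := by
    rw [mvfderiv_warpIncl_derivAlong hDbar ha ha0 ((hf.1 x).mdifferentiableAt (by simp))
      (mdifferentiableAt_mfderiv_apply hf.1 hV)]
    simp only [← mvfderiv_warpMap hf.1]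
    rfl
  have htan : tangentPart g (ambientMetric ε J a o) f x
      (derivAlong Dbar f (fun y => mfderiv I (𝓘(ℝ, ℝ).prod (𝓡 N)) f y (V y)) x u) =
      D V x u := by
    rw [← sub_eq_zero]
    refine g.nondegenerate x _ fun w => ?_
    rw [map_sub, sub_apply, inner_tangentPart, ambientMetric_eq_warpForm, hder,
      ← mvfderiv_warpMap hf.1, ← warpForm_warpDeriv_eq (sign_mul_self ε) hΦ
        (fun y => flatMetric_warpIncl (f y)) (inner_eq_warpForm hf) hD ha ha0 hV]
    exact sub_self _
  have hα : mvfderiv (𝓘(ℝ, ℝ).prod (𝓡 N)) (warpIncl J o) (f x)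
      (secondFundamentalForm g (ambientMetric ε J a o) Dbar f x u (Z x)) =
      warpDeriv I ((ε : ℤ) : ℝ) ((c : ℤ) : ℝ) ν a (warpMap f)
          (fun y => mvfderiv I (warpMap f) y (V y)) x u -
        mvfderiv I (warpMap f) x (D V x u) := by
    rw [secondFundamentalForm, normalPart, map_sub, ← hVdef, htan, hder, mvfderiv_warpMap hf.1]
  -- Both sides are tensorial in `Z`, so `V` may be replaced by `Z`.
  obtain ⟨U, hU, hUx⟩ : ∃ U : ∀ y : M, TangentSpace I y,
      MDifferentiableAt I I.tangent (fun y => (⟨y, U y⟩ : TangentBundle I M)) x ∧ U x = u :=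
    ⟨_, hext u, FiberBundle.extend_apply_self E u⟩
  have t1 := D.torsion_eq_zero_iff.1 hD.1 hU hZ
  have t2 := D.torsion_eq_zero_iff.1 hD.1 hU hV
  have t3 := warpDeriv_mvfderiv_sub (ε := ((ε : ℤ) : ℝ)) (c := ((c : ℤ) : ℝ)) (ν := ν) (a := a)
    hΦ hU hZ
  have t4 := warpDeriv_mvfderiv_sub (ε := ((ε : ℤ) : ℝ)) (c := ((c : ℤ) : ℝ)) (ν := ν) (a := a)
    hΦ hU hV
  rw [← t1, map_sub] at t3
  rw [← t2, map_sub] at t4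
  rw [hUx] at t3 t4
  rw [hVx] at t4
  rw [hα, eq_sub_iff_add_eq]
  rw [sub_eq_iff_eq_add] at t3 t4
  rw [t3, t4]
  abel

section Normal

variable {η : ∀ y : M, TangentSpace (𝓘(ℝ, ℝ).prod (𝓡 N)) (f y)}

theorem ambientMetric_secondFundamentalForm
    (hf : IsIsometricImmersion g (ambientMetric ε J a o) f) (hD : IsLeviCivita g.inner D)
    (hDbar : IsLeviCivita (ambientMetric ε J a o) Dbar) {x : M}
    (ha : DifferentiableAt ℝ a (f x).1) (ha0 : a (f x).1 ≠ 0) {Z : ∀ y : M, TangentSpace I y}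
    (hZ : MDifferentiableAt I I.tangent (fun y => (⟨y, Z y⟩ : TangentBundle I M)) x)
    (hη : IsNormal (I := I) (ambientMetric ε J a o) f x (η x)) (u : TangentSpace I x) :
    ambientMetric ε J a o (f x)
        (secondFundamentalForm g (ambientMetric ε J a o) Dbar f x u (Z x)) (η x) =
      warpForm ((ε : ℤ) : ℝ) ν a (warpMap f x)
        (warpDeriv I ((ε : ℤ) : ℝ) ((c : ℤ) : ℝ) ν a (warpMap f)
          (fun y => mvfderiv I (warpMap f) y (Z y)) x u) (warpField f η x) := by
  have h1 := (isNormal_iff_warpForm hf.1 x (η x)).1 hη (D Z x u)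
  rw [ambientMetric_eq_warpForm,
    mvfderiv_warpIncl_secondFundamentalForm hf hD hDbar ha ha0 hZ, warpForm_sub_left]
  exact (congrArg _ h1).trans (sub_zero _)

theorem ambientMetric_secondFundamentalForm_normalConnection
    (hf : IsIsometricImmersion g (ambientMetric ε J a o) f) (hD : IsLeviCivita g.inner D)
    (hDbar : IsLeviCivita (ambientMetric ε J a o) Dbar) {x : M}
    (ha : DifferentiableAt ℝ a (f x).1) (ha0 : a (f x).1 ≠ 0) {Z : ∀ y : M, TangentSpace I y}
    (hZ : MDifferentiableAt I I.tangent (fun y => (⟨y, Z y⟩ : TangentBundle I M)) x)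
    (hη : MDifferentiableAt I (𝓘(ℝ, ℝ).prod (𝓡 N)).tangent
      (fun y => (⟨f y, η y⟩ : TangentBundle (𝓘(ℝ, ℝ).prod (𝓡 N)) (J × spaceForm o))) x)
    (u w : TangentSpace I x) :
    ambientMetric ε J a o (f x)
        (secondFundamentalForm g (ambientMetric ε J a o) Dbar f x u (Z x))
        (normalConnection g (ambientMetric ε J a o) Dbar f η x w) =
      warpForm ((ε : ℤ) : ℝ) ν a (warpMap f x)
          (warpDeriv I ((ε : ℤ) : ℝ) ((c : ℤ) : ℝ) ν a (warpMap f)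
            (fun y => mvfderiv I (warpMap f) y (Z y)) x u)
          (warpDeriv I ((ε : ℤ) : ℝ) ((c : ℤ) : ℝ) ν a (warpMap f) (warpField f η) x w) -
        warpForm ((ε : ℤ) : ℝ) ν a (warpMap f x) (mvfderiv I (warpMap f) x (D Z x u))
          (warpDeriv I ((ε : ℤ) : ℝ) ((c : ℤ) : ℝ) ν a (warpMap f) (warpField f η) x w) := by
  have h1 : IsNormal (I := I) (ambientMetric ε J a o) f x
      (secondFundamentalForm g (ambientMetric ε J a o) Dbar f x u (Z x)) :=
    isNormal_normalPart hf x _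
  rw [normalConnection, normalPart, map_sub, h1, sub_zero, ambientMetric_eq_warpForm,
    mvfderiv_warpIncl_secondFundamentalForm hf hD hDbar ha ha0 hZ, warpForm_sub_left,
    mvfderiv_warpIncl_derivAlong hDbar ha ha0 ((hf.1 x).mdifferentiableAt (by simp)) hη]
  rfl

theorem warpForm_mvfderiv_warpDeriv_normal
    (hf : IsIsometricImmersion g (ambientMetric ε J a o) f) {x : M}
    (ha : DifferentiableAt ℝ a (f x).1) (ha0 : a (f x).1 ≠ 0) {V : ∀ y : M, TangentSpace I y}
    (hV : MDifferentiableAt I I.tangent (fun y => (⟨y, V y⟩ : TangentBundle I M)) x)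
    (hη : MDifferentiableAt I 𝓘(ℝ, ℝ × Ambient N) (warpField f η) x)
    (hη_normal : ∀ᶠ y in 𝓝 x, IsNormal (I := I) (ambientMetric ε J a o) f y (η y))
    (w : TangentSpace I x) :
    warpForm ((ε : ℤ) : ℝ) ν a (warpMap f x) (mvfderiv I (warpMap f) x (V x))
        (warpDeriv I ((ε : ℤ) : ℝ) ((c : ℤ) : ℝ) ν a (warpMap f) (warpField f η) x w) =
      -warpForm ((ε : ℤ) : ℝ) ν a (warpMap f x)
        (warpDeriv I ((ε : ℤ) : ℝ) ((c : ℤ) : ℝ) ν a (warpMap f)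
          (fun y => mvfderiv I (warpMap f) y (V y)) x w) (warpField f η x) := by
  have : CompleteSpace E := FiniteDimensional.complete ℝ E
  have hΦ := contMDiff_warpMap hf.1
  have hΦx : MDifferentiableAt I 𝓘(ℝ, ℝ × Ambient N) (warpMap f) x :=
    (hΦ x).mdifferentiableAt (by simp)
  have h1 := hasVDeriv_warpForm (u := w) (c := ((c : ℤ) : ℝ)) (ν := ν) (sign_mul_self ε)
    (Φ := warpMap f) ha ha0 hΦx
    (mdifferentiableAt_mvfderiv_apply_and_bracket ((hΦ x).of_le ENat.LEInfty.out) hV hV).1 hη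
    (flatMetric_mvfderiv_eq_zero hΦx fun y => flatMetric_warpIncl (f y))
    (flatMetric_warpField η x)
  have h2 := h1.unique ((hasVDeriv_const (0 : ℝ) x w).congr_of_eventuallyEq (by
    filter_upwards [hη_normal] with y hy
    exact (isNormal_iff_warpForm hf.1 y (η y)).1 hy (V y)))
  linarith

theorem covDerivSecondFundamentalForm_eq
    (hf : IsIsometricImmersion g (ambientMetric ε J a o) f) (hD : IsLeviCivita g.inner D)
    (hDbar : IsLeviCivita (ambientMetric ε J a o) Dbar)
    (ha : ContDiffOn ℝ ∞ a J) (ha0 : ∀ t ∈ J, a t ≠ 0)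
    {x : M} {X Y Z : ∀ y : M, TangentSpace I y}
    (hX : ContMDiffAt I I.tangent ∞ (fun y => (⟨y, X y⟩ : TangentBundle I M)) x)
    (hZ : ContMDiffAt I I.tangent ∞ (fun y => (⟨y, Z y⟩ : TangentBundle I M)) x)
    (hη : ContMDiffAt I (𝓘(ℝ, ℝ).prod (𝓡 N)).tangent ∞
      (fun y => (⟨f y, η y⟩ : TangentBundle (𝓘(ℝ, ℝ).prod (𝓡 N)) (J × spaceForm o))) x)
    (hη_normal : ∀ᶠ y in 𝓝 x, IsNormal (I := I) (ambientMetric ε J a o) f y (η y)) :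
    covDerivSecondFundamentalForm g (ambientMetric ε J a o) Dbar f D Y X Z η x =
      warpForm ((ε : ℤ) : ℝ) ν a (warpMap f x)
          (warpDeriv I ((ε : ℤ) : ℝ) ((c : ℤ) : ℝ) ν a (warpMap f)
            (fun y => warpDeriv I ((ε : ℤ) : ℝ) ((c : ℤ) : ℝ) ν a (warpMap f)
              (fun y => mvfderiv I (warpMap f) y (Z y)) y (X y)) x (Y x)) (warpField f η x) -
        warpForm ((ε : ℤ) : ℝ) ν a (warpMap f x)
          (warpDeriv I ((ε : ℤ) : ℝ) ((c : ℤ) : ℝ) ν a (warpMap f)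
            (fun y => mvfderiv I (warpMap f) y (Z y)) x (D X x (Y x))) (warpField f η x) -
        ambientMetric ε J a o (f x)
          (secondFundamentalForm g (ambientMetric ε J a o) Dbar f x (X x) (D Z x (Y x))) (η x) -
        ambientMetric ε J a o (f x)
          (secondFundamentalForm g (ambientMetric ε J a o) Dbar f x (Y x) (D Z x (X x)))
          (η x) := by
  have : CompleteSpace E := FiniteDimensional.complete ℝ E
  have : IsManifold I 1 M := .of_le (n := ∞) (by simp)
  have hd (y : M) := differentiableAt_warp J.isOpen ha (f y).1.2
  have hd0 (y : M) : a (f y).1 ≠ 0 := ha0 _ (f y).1.2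
  have hΦ := contMDiff_warpMap hf.1
  have hΦx : MDifferentiableAt I 𝓘(ℝ, ℝ × Ambient N) (warpMap f) x :=
    (hΦ x).mdifferentiableAt (by simp)
  have hX' := hX.mdifferentiableAt (by simp)
  have hZ' := hZ.mdifferentiableAt (by simp)
  have hη' := hη.mdifferentiableAt (by simp)
  have hηf := (contMDiffAt_warpField hη).mdifferentiableAt (by simp)
  have hZev : ∀ᶠ y in 𝓝 x,
      MDifferentiableAt I I.tangent (fun y => (⟨y, Z y⟩ : TangentBundle I M)) y := by
    filter_upwards [(contMDiffAt_iff_contMDiffAt_nhds (n := 1) (by simp)).1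
      (hZ.of_le (by simp))] with y hy
    exact hy.mdifferentiableAt (by simp)
  have hW : ContMDiffAt I 𝓘(ℝ, ℝ × Ambient N) ∞ (fun y => mvfderiv I (warpMap f) y (Z y)) x :=
    (contMDiff_mvfderiv_tangentBundle hΦ _).comp x hZ
  have hWd : ∀ᶠ y in 𝓝 x, MDifferentiableAt I 𝓘(ℝ, ℝ × Ambient N)
      (fun y => mvfderiv I (warpMap f) y (Z y)) y := by
    filter_upwards [hZev] with y hy
    exact (mdifferentiableAt_mvfderiv_apply_and_bracket
      ((hΦ y).of_le ENat.LEInfty.out) hy hy).1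
  have he := mdifferentiableAt_warpDeriv (Φ := warpMap f) (ε := ((ε : ℤ) : ℝ))
    (c := ((c : ℤ) : ℝ)) (ν := ν) (hd x).1 (hd x).2 (hd0 x) ((hΦ x).of_le ENat.LEInfty.out)
    (hW.of_le ENat.LEInfty.out) hX'
  have hperp : flatMetric N ν (warpMap f x).2
      (warpDeriv I ((ε : ℤ) : ℝ) ((c : ℤ) : ℝ) ν a (warpMap f)
        (fun y => mvfderiv I (warpMap f) y (Z y)) x (X x)).2 = 0 :=
    flatMetric_warpDeriv_eq_zero (sign_mul_self c) hΦx hWd.self_of_nhds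
      (fun y => flatMetric_warpIncl (f y)) (Filter.Eventually.of_forall fun y =>
        flatMetric_mvfderiv_eq_zero ((hΦ y).mdifferentiableAt (by simp))
          fun z => flatMetric_warpIncl (f z))
  have h1 := (hasVDeriv_warpForm (u := Y x) (c := ((c : ℤ) : ℝ)) (ν := ν) (sign_mul_self ε)
    (Φ := warpMap f) (hd x).1 (hd0 x) hΦx he hηf hperp (flatMetric_warpField η x))
  have h2 : HasVDeriv I (fun y => ambientMetric ε J a o (f y)
      (secondFundamentalForm g (ambientMetric ε J a o) Dbar f y (X y) (Z y)) (η y)) x (Y x) _ :=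
    h1.congr_of_eventuallyEq (by
      filter_upwards [hZev, hη_normal] with y hy hny
      exact ambientMetric_secondFundamentalForm hf hD hDbar (hd y).1 (hd0 y) hy hny (X y))
  have hext := FiberBundle.mdifferentiableAt_extend I E (D Z x (X x))
  have h3 := warpForm_mvfderiv_warpDeriv_normal hf (hd x).1 (hd0 x) hext hηf hη_normal (Y x)
  have h4 := ambientMetric_secondFundamentalForm hf hD hDbar (hd x).1 (hd0 x) hext
    hη_normal.self_of_nhds (Y x)
  rw [← h4, FiberBundle.extend_apply_self] at h3
  rw [covDerivSecondFundamentalForm, h2.2,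
    ambientMetric_secondFundamentalForm hf hD hDbar (hd x).1 (hd0 x) hZ' hη_normal.self_of_nhds,
    ambientMetric_secondFundamentalForm_normalConnection hf hD hDbar (hd x).1 (hd0 x) hZ' hη',
    h3]
  ring

end Normal

omit [FiniteDimensional ℝ E] [I.Boundaryless] [IsManifold I ∞ M] in
theorem warpDeriv_sub_direction (Φ W : M → ℝ × Ambient N) (x : M) (u v : TangentSpace I x)
    (ε c : ℝ) :
    warpDeriv I ε c ν a Φ W x (u - v) =
      warpDeriv I ε c ν a Φ W x u - warpDeriv I ε c ν a Φ W x v := by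
  simp only [warpDeriv, map_sub, christoffel_comm ε c ν a _ _ (W x), christoffel_sub_right]
  abel

omit [I.Boundaryless] in
theorem inner_tangentT (hf : IsIsometricImmersion g (ambientMetric ε J a o) f) (x : M)
    (u : TangentSpace I x) :
    g.inner x (tangentT ε g f x) u = ((ε : ℤ) : ℝ) * (mvfderiv I (warpMap f) x u).1 := by
  rw [tangentT, SemiRiemannianMetric.grad, map_smul, smul_apply, g.inner_sharp, smul_eq_mul]
  congr 1
  exact ((((contMDiff_warpMap hf.1) x).mdifferentiableAt (by simp)).hasVDeriv u).fst.2

omit [I.Boundaryless] in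
theorem ambientMetric_normalXi {x : M} {w : TangentSpace (𝓘(ℝ, ℝ).prod (𝓡 N)) (f x)}
    (hf : ContMDiff I (𝓘(ℝ, ℝ).prod (𝓡 N)) ∞ f)
    (hw : IsNormal (I := I) (ambientMetric ε J a o) f x w) :
    ambientMetric ε J a o (f x) (normalXi (𝓡 N) ε g f x) w =
      ((ε : ℤ) : ℝ) * (mvfderiv (𝓘(ℝ, ℝ).prod (𝓡 N)) (warpIncl J o) (f x) w).1 := by
  have h1 := (isNormal_iff_warpForm hf x w).1 hw (tangentT ε g f x)
  rw [mvfderiv_warpMap hf] at h1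
  rw [normalXi, ambientMetric_eq_warpForm, map_sub, warpForm_sub_left,
    mvfderiv_warpIncl_partialT]
  refine (congrArg _ h1).trans ?_
  simp [warpForm]

end WarpedImmersion

end WarpedCodazzi

end

theorem proposition3p3
    {N n l : ℕ} (hN : 2 ≤ N) (hl : l ≤ N) (ε c : ℤˣ)
    -- the space form: the component of the hyperquadric through the point `o`
    (o : Quadric N (ambientIndex l c) c)
    -- the interval and the scale factor
    (J : TopologicalSpace.Opens ℝ) (hJ : (J : Set ℝ).OrdConnected)
    (a : ℝ → ℝ) (ha : ContDiffOn ℝ ∞ a J) (ha_pos : ∀ t ∈ J, 0 < a t)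
    -- the semi-Riemannian manifold and its isometric immersion into the warped product
    {M : Type*} [TopologicalSpace M] [ChartedSpace (EuclideanSpace ℝ (Fin n)) M]
    [IsManifold (𝓡 n) ∞ M] (g : SemiRiemannianMetric (𝓡 n) M)
    (f : M → J × spaceForm o) (hf : IsIsometricImmersion g (ambientMetric ε J a o) f)
    -- the Levi-Civita connections of the manifold and of the warped product
    (D : CovariantDerivative (𝓡 n) (EuclideanSpace ℝ (Fin n)) (TangentSpace (𝓡 n) : M → Type _))
    (hD : IsLeviCivita g.inner D)
    (Dbar : CovariantDerivative (𝓘(ℝ, ℝ).prod (𝓡 N)) (ℝ × EuclideanSpace ℝ (Fin N))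
      (TangentSpace (𝓘(ℝ, ℝ).prod (𝓡 N)) : J × spaceForm o → Type _))
    (hDbar : IsLeviCivita (ambientMetric ε J a o) Dbar)
    -- vector fields and a normal field, smooth around the point `x`
    (x : M) (X Y Z : ∀ y : M, TangentSpace (𝓡 n) y)
    (hX : ContMDiffAt (𝓡 n) (𝓡 n).tangent ∞ (fun y => (⟨y, X y⟩ : TangentBundle (𝓡 n) M)) x)
    (hY : ContMDiffAt (𝓡 n) (𝓡 n).tangent ∞ (fun y => (⟨y, Y y⟩ : TangentBundle (𝓡 n) M)) x)
    (hZ : ContMDiffAt (𝓡 n) (𝓡 n).tangent ∞ (fun y => (⟨y, Z y⟩ : TangentBundle (𝓡 n) M)) x)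
    (η : ∀ y : M, TangentSpace (𝓘(ℝ, ℝ).prod (𝓡 N)) (f y))
    (hη : ContMDiffAt (𝓡 n) (𝓘(ℝ, ℝ).prod (𝓡 N)).tangent ∞
      (fun y => (⟨f y, η y⟩ : TangentBundle (𝓘(ℝ, ℝ).prod (𝓡 N)) (J × spaceForm o))) x)
    (hη_normal : ∀ᶠ y in 𝓝 x, IsNormal (I := 𝓡 n) (ambientMetric ε J a o) f y (η y)) :
    covDerivSecondFundamentalForm g (ambientMetric ε J a o) Dbar f D Y X Z η x -
        covDerivSecondFundamentalForm g (ambientMetric ε J a o) Dbar f D X Y Z η x =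
      (deriv (deriv a) (f x).1 / a (f x).1 - deriv a (f x).1 ^ 2 / a (f x).1 ^ 2 +
          ((ε : ℤ) : ℝ) * ((c : ℤ) : ℝ) / a (f x).1 ^ 2) *
        (ambientMetric ε J a o) (f x) (normalXi (𝓡 N) ε g f x) (η x) *
        (g.inner x (tangentT ε g f x) (X x) * g.inner x (Y x) (Z x) -
          g.inner x (tangentT ε g f x) (Y x) * g.inner x (X x) (Z x)) := by
  have ha0 : ∀ t ∈ J, a t ≠ 0 := fun t ht => (ha_pos t ht).ne'
  have hd := differentiableAt_warp J.isOpen ha (f x).1.2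
  have hΦ := (contMDiff_warpMap hf.1 x).of_le (m := 2) ENat.LEInfty.out
  have hX' := hX.mdifferentiableAt (by simp)
  have hY' := hY.mdifferentiableAt (by simp)
  have hW : ContMDiffAt (𝓡 n) 𝓘(ℝ, ℝ × Ambient N) ∞
      (fun y => mvfderiv (𝓡 n) (warpMap f) y (Z y)) x :=
    (contMDiff_mvfderiv_tangentBundle (contMDiff_warpMap hf.1) _).comp x hZ
  have hnormal := hη_normal.self_of_nhds
  have hη0 := (isNormal_iff_warpForm hf.1 x (η x)).1 hnormal
  have hR := warpForm_curvature (Φ := warpMap f) (sign_mul_self ε) hd.1 hd.2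
    (ha0 _ (f x).1.2) hΦ (hW.of_le ENat.LEInfty.out) hX' hY'
    (fun y => flatMetric_warpIncl (f y)) (flatMetric_warpField η x) (hη0 (X x)) (hη0 (Y x))
  rw [← D.torsion_eq_zero_iff.1 hD.1 hY' hX', warpDeriv_sub_direction, warpForm_sub_left,
    ← inner_eq_warpForm hf, ← inner_eq_warpForm hf] at hR
  rw [covDerivSecondFundamentalForm_eq hf hD hDbar ha ha0 hX hZ hη hη_normal,
    covDerivSecondFundamentalForm_eq hf hD hDbar ha ha0 hY hZ hη hη_normal,
    inner_tangentT hf, inner_tangentT hf, ambientMetric_normalXi hf.1 hnormal]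
  have hwarp : (warpMap f x).1 = (f x).1 := rfl
  have hfield : warpField f η x =
    mvfderiv (𝓘(ℝ, ℝ).prod (𝓡 N)) (warpIncl J o) (f x) (η x) := rfl
  rw [hwarp] at hR
  rw [← hfield]
  have hε := sign_mul_self ε
  linear_combination hR + (-(deriv (deriv a) (f x).1 / a (f x).1 -
    deriv a (f x).1 ^ 2 / a (f x).1 ^ 2 + ((ε : ℤ) : ℝ) * ((c : ℤ) : ℝ) / a (f x).1 ^ 2) *
    (warpField f η x).1 * ((mvfderiv (𝓡 n) (warpMap f) x (X x)).1 * g.inner x (Y x) (Z x) -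
      (mvfderiv (𝓡 n) (warpMap f) x (Y x)).1 * g.inner x (X x) (Z x))) * hε
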